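/- Let $G=\mathrm{Aff}_+(\mathbb R)=\{(x,y)\in\mathbb R^2 : y>0\}$ with product $(x_2,y_2)\cdot(x_1,y_1)=(x_2+y_2x_1,\,y_2y_1)$, identity $\mathrm{Id}=(0,1)$ and left-invariant frame $X_1=y\,\partial_x$, $X_2=y\,\partial_y$. Let $A=\begin{pmatrix}a&b\\c&d\end{pmatrix}$ be a real matrix with $\det A>0$ and $a\ge 0$, and let $\begin{pmatrix}\alpha&\beta\\\gamma&\delta\end{pmatrix}=A^{-1}$, $Y_1=\alpha X_1+\gamma X_2$, $Y_2=\beta X_1+\delta X_2$. Equip $G$ with the left-invariant Lorentzian metric $g(u_1X_1+u_2X_2)=-(au_1+bu_2)^2+(cu_1+du_2)^2$, for which $Y_1,Y_2$ is an orthonormal frame, time-oriented by $Y_1$. It has constant sectional curvature, denoted by $K$. A future directed nonspacelike curve is a Lipschitz curve $q:[0,T]\to G$, $T\geq 0$, with $g(\dot q)\le 0$ and $\bar g(\dot q,Y_1)<0$ almost everywhere ($\bar g$ is the bilinear form of $g$); its length is $\int_0^T|g(\dot q)|^{1/2}dt$. It is a Lorentzian length maximizer if no future directed nonspacelike curve with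 the same endpoints is longer. Let $J^+$ be the set of endpoints of future directed nonspacelike curves starting at $\mathrm{Id}$. Let $$\lambda_1=(c-a)x+(d-b)(y-1),\qquad \lambda_2=(c+a)x+(d+b)(y-1),\qquad \lambda_3=\lambda_1-\lambda_1(B),$$ where $B=\bigl(\tfrac{d+b}{c+a},0\bigr)$, and let $D=\{q\in G:\lambda_1(q)\le 0\le\lambda_2(q),\ \lambda_3(q)>0\}$; $B$ and $D$ are used only for $K<0$, in which case $c+a>0$. Set $M=\operatorname{int}D$ if $K<0$, and $M=\operatorname{int}J^+$ if $K\ge 0$. On $T^*G$ let $h_i(\lambda)=\langle\lambda,Y_i\rangle$ and $H=\tfrac12(-h_1^2+h_2^2)$, with Hamiltonian vector field $\vec H$. Let $C=\{\lambda\in T^*_{\mathrm{Id}}G : H(\lambda)=-\tfrac12,\ h_1(\lambda)<0\}$, a smooth curve with the global coordinate $\psi\in\mathbb R$ given by $h_1=-\cosh\psi$, $h_2=\sinh\psi$. For $\lambda_0\in C$ let $t_{\max}(\lambda_0)\in(0,+\infty]$ be the right end of the maximal interval of existence of the solution of $\dot\lambda=\vec H(\lambda)$, $\lambda(0)=\lambda_0$,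 and for $0\le t<t_{\max}(\lambda_0)$ let $\mathrm{Exp}(\lambda_0,t)$ be the projection to $G$ of this solution at time $t$. Let $N=\{(\lambda_0,t) : \lambda_0\in C,\ 0<t<t_{\max}(\lambda_0)\}$. Then: 1. $\mathrm{Exp}(N)\subset M$. 2. $\mathrm{Exp}:N\to M$ is a ($C^\infty$) diffeomorphism. 3. For every $\lambda_0\in C$ and every $t_1\in(0,t_{\max}(\lambda_0))$ the trajectory $t\mapsto\mathrm{Exp}(\lambda_0,t)$, $t\in[0,t_1]$, is a Lorentzian length maximizer from $\mathrm{Id}$ to $\mathrm{Exp}(\lambda_0,t_1)$. -/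

import Mathlib

open scoped ContDiff Matrix

namespace AffLorentz

noncomputable section

/-! ### The group of proper affine maps of the line and its left-invariant frame

`(x, y)` with `y > 0` stands for the map `s ↦ y * s + x`; tangent vectors at any point are written
in the coordinates `(x, y)` as elements of `ℝ × ℝ`. -/

/-- The group `G = Aff₊(ℝ)`, the open upper half-plane. -/
def G : Set (ℝ × ℝ) := {q | 0 < q.2}

/-- The group product `(x₂, y₂) · (x₁, y₁) = (x₂ + y₂ x₁, y₂ y₁)`. -/
def mul (p q : ℝ × ℝ) : ℝ × ℝ := (p.1 + p.2 * q.1, p.2 * q.2)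

/-- The identity element of `G`. -/
def Id : ℝ × ℝ := (0, 1)

/-- The left-invariant vector field `X₁ = y ∂/∂x`. -/
def X₁ (q : ℝ × ℝ) : ℝ × ℝ := (q.2, 0)

/-- The left-invariant vector field `X₂ = y ∂/∂y`. -/
def X₂ (q : ℝ × ℝ) : ℝ × ℝ := (0, q.2)

/-- The coordinates `(u₁, u₂)` of a tangent vector `v` at `q` in the frame: `v = u₁ X₁ + u₂ X₂`. -/
def frameCoord (q v : ℝ × ℝ) : Fin 2 → ℝ := ![v.1 / q.2, v.2 / q.2]

theorem frameCoord_spec {q : ℝ × ℝ} (hq : q ∈ G) (v : ℝ × ℝ) :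
    frameCoord q v 0 • X₁ q + frameCoord q v 1 • X₂ q = v := by
  have h : q.2 ≠ 0 := ne_of_gt hq
  ext <;> simp [frameCoord, X₁, X₂, h]

/-! ### The left-invariant Lorentzian structure given by a matrix `A = !![a, b; c, d]` -/

/-- The bilinear form on the Lie algebra polar to the quadratic form
`g(u) = -(a u₁ + b u₂)² + (c u₁ + d u₂)²`. -/
def lieForm (A : Matrix (Fin 2) (Fin 2) ℝ) (u w : Fin 2 → ℝ) : ℝ :=
  -((A *ᵥ u) 0 * (A *ᵥ w) 0) + (A *ᵥ u) 1 * (A *ᵥ w) 1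

/-- The Lorentzian metric at the point `q`. -/
def metric (A : Matrix (Fin 2) (Fin 2) ℝ) (q v w : ℝ × ℝ) : ℝ :=
  lieForm A (frameCoord q v) (frameCoord q w)

/-- The metric is invariant under left translations. -/
theorem metric_leftInvariant (A : Matrix (Fin 2) (Fin 2) ℝ) {p : ℝ × ℝ} (hp : p ∈ G)
    (q v w : ℝ × ℝ) :
    metric A (mul p q) (fderiv ℝ (mul p) q v) (fderiv ℝ (mul p) q w) = metric A q v w := by
  have hp' : p.2 ≠ 0 := ne_of_gt hp
  have hd : ∀ v : ℝ × ℝ, fderiv ℝ (mul p) q v = p.2 • v := by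
    have h : HasFDerivAt (mul p) (p.2 • ContinuousLinearMap.id ℝ (ℝ × ℝ)) q := by
      have h1 : HasFDerivAt (fun z : ℝ × ℝ => (p.1, (0 : ℝ)) + p.2 • z)
          (p.2 • ContinuousLinearMap.id ℝ (ℝ × ℝ)) q :=
        ((hasFDerivAt_id q).const_smul p.2).const_add _
      have h2 : mul p = fun z : ℝ × ℝ => (p.1, (0 : ℝ)) + p.2 • z := by
        funext z
        ext <;> simp [mul]
      rw [h2]
      exact h1
    intro v
    rw [h.fderiv]
    simp
  have hf : ∀ v : ℝ × ℝ, frameCoord (mul p q) (p.2 • v) = frameCoord q v := by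
    intro v
    simp only [frameCoord, mul, Prod.smul_fst, Prod.smul_snd, smul_eq_mul]
    rw [mul_div_mul_left _ _ hp', mul_div_mul_left _ _ hp']
  simp only [metric, hd, hf]

/-- The orthonormal frame `Y₁ = α X₁ + γ X₂`, `Y₂ = β X₁ + δ X₂` with
`!![α, β; γ, δ] = A⁻¹`; `Y A 0` is `Y₁` and `Y A 1` is `Y₂`. -/
def Y (A : Matrix (Fin 2) (Fin 2) ℝ) (j : Fin 2) (q : ℝ × ℝ) : ℝ × ℝ :=
  A⁻¹ 0 j • X₁ q + A⁻¹ 1 j • X₂ q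

/-- A future directed nonspacelike tangent vector `v` at `q`; the time orientation is `Y₁`. -/
def IsFutureNonspacelike (A : Matrix (Fin 2) (Fin 2) ℝ) (q v : ℝ × ℝ) : Prop :=
  metric A q v v ≤ 0 ∧ metric A q v (Y A 0 q) < 0

/-! ### Curves, length, causal future, length maximizers -/

/-- A future directed nonspacelike Lipschitzian curve `q : [0, T] → G`. -/
def IsFutureCurve (A : Matrix (Fin 2) (Fin 2) ℝ) (T : ℝ) (q : ℝ → ℝ × ℝ) : Prop :=
  0 ≤ T ∧ (∀ t ∈ Set.Icc 0 T, q t ∈ G) ∧ (∃ L, LipschitzOnWith L q (Set.Icc 0 T)) ∧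
    ∀ᵐ t ∂(MeasureTheory.volume.restrict (Set.Icc 0 T)),
      IsFutureNonspacelike A (q t) (deriv q t)

/-- The Lorentzian length of a curve on `[0, T]`. -/
def length (A : Matrix (Fin 2) (Fin 2) ℝ) (T : ℝ) (q : ℝ → ℝ × ℝ) : ℝ :=
  ∫ t in (0 : ℝ)..T, Real.sqrt |metric A (q t) (deriv q t) (deriv q t)|

/-- The causal future `J⁺(q₀)`. -/
def causalFuture (A : Matrix (Fin 2) (Fin 2) ℝ) (q₀ : ℝ × ℝ) : Set (ℝ × ℝ) :=
  {q₁ | ∃ T q, IsFutureCurve A T q ∧ q 0 = q₀ ∧ q T = q₁}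

/-- The curve `q` on `[0, T]` is a Lorentzian length maximizer from `q₀` to `q₁`. -/
def IsLengthMaximizer (A : Matrix (Fin 2) (Fin 2) ℝ) (q₀ q₁ : ℝ × ℝ) (T : ℝ)
    (q : ℝ → ℝ × ℝ) : Prop :=
  IsFutureCurve A T q ∧ q 0 = q₀ ∧ q T = q₁ ∧
    ∀ T' q', IsFutureCurve A T' q' → q' 0 = q₀ → q' T' = q₁ → length A T' q' ≤ length A T q

/-! ### Sectional curvature, in the global chart `(x, y)` -/

/-- The coordinate vectors `∂/∂x`, `∂/∂y`. -/
def e : Fin 2 → ℝ × ℝ := ![(1, 0), (0, 1)]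

/-- The components of a tangent vector. -/
def comp (v : ℝ × ℝ) : Fin 2 → ℝ := ![v.1, v.2]

/-- The matrix of the metric in the coordinates `(x, y)`. -/
def gram (A : Matrix (Fin 2) (Fin 2) ℝ) (q : ℝ × ℝ) : Matrix (Fin 2) (Fin 2) ℝ :=
  Matrix.of fun i j => metric A q (e i) (e j)

/-- The partial derivative in the direction of the `i`-th coordinate. -/
def pd (i : Fin 2) (f : ℝ × ℝ → ℝ) (q : ℝ × ℝ) : ℝ := fderiv ℝ f q (e i)

/-- The Christoffel symbols `Γᵏᵢⱼ` of the Levi-Civita connection. -/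
def christoffel (A : Matrix (Fin 2) (Fin 2) ℝ) (k i j : Fin 2) (q : ℝ × ℝ) : ℝ :=
  (1 / 2) * ∑ l, (gram A q)⁻¹ k l *
    (pd i (fun p => gram A p j l) q + pd j (fun p => gram A p i l) q
      - pd l (fun p => gram A p i j) q)

/-- The components of the curvature tensor `R_{VW} Z = D_{[V,W]} Z - [D_V, D_W] Z`:
`R_{∂ₖ ∂ₗ} ∂ⱼ = ∑ᵢ riemann A i j k l • ∂ᵢ`. -/
def riemann (A : Matrix (Fin 2) (Fin 2) ℝ) (i j k l : Fin 2) (q : ℝ × ℝ) : ℝ :=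
  pd l (christoffel A i k j) q - pd k (christoffel A i l j) q
    + ∑ m, (christoffel A i l m q * christoffel A m k j q
      - christoffel A i k m q * christoffel A m l j q)

/-- The vector `R_{vw} z` at the point `q`. -/
def curv (A : Matrix (Fin 2) (Fin 2) ℝ) (q v w z : ℝ × ℝ) : ℝ × ℝ :=
  ∑ i, (∑ j, ∑ k, ∑ l, comp z j * comp v k * comp w l * riemann A i j k l q) • e i

/-- `Q(v, w) = g(v, v) g(w, w) - g(v, w)²`. -/
def gramDet (A : Matrix (Fin 2) (Fin 2) ℝ) (q v w : ℝ × ℝ) : ℝ :=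
  metric A q v v * metric A q w w - metric A q v w ^ 2

/-- The sectional curvature `g(R_{vw} v, w) / Q(v, w)` of the plane spanned by `v`, `w` at `q`. -/
def sectionalCurvature (A : Matrix (Fin 2) (Fin 2) ℝ) (q v w : ℝ × ℝ) : ℝ :=
  metric A q (curv A q v w v) w / gramDet A q v w

/-- The curvature `K` of the structure, which does not depend on the point, see
`sectionalCurvature_eq_K`. -/
def K (A : Matrix (Fin 2) (Fin 2) ℝ) : ℝ := sectionalCurvature A Id (X₁ Id) (X₂ Id)

theorem pd_of_hasDerivAt (i : Fin 2) (f : ℝ → ℝ) (f' : ℝ) (q : ℝ × ℝ)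
    (h : HasDerivAt f f' q.2) : pd i (fun p => f p.2) q = comp (0, f') i := by
  have h1 : HasFDerivAt (fun p : ℝ × ℝ => f p.2) (f' • ContinuousLinearMap.snd ℝ ℝ ℝ) q :=
    h.comp_hasFDerivAt q hasFDerivAt_snd
  rw [pd, h1.fderiv]
  fin_cases i <;> simp [e, comp]

/-- The matrix of the metric at the identity. -/
def gramId (A : Matrix (Fin 2) (Fin 2) ℝ) : Matrix (Fin 2) (Fin 2) ℝ :=
  !![A 1 0 ^ 2 - A 0 0 ^ 2, A 1 0 * A 1 1 - A 0 0 * A 0 1;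
    A 1 0 * A 1 1 - A 0 0 * A 0 1, A 1 1 ^ 2 - A 0 1 ^ 2]

theorem gram_apply (A : Matrix (Fin 2) (Fin 2) ℝ) (q : ℝ × ℝ) (i j : Fin 2) :
    gram A q i j = gramId A i j * (q.2 ^ 2)⁻¹ := by
  fin_cases i <;> fin_cases j <;>
    simp [gram, gramId, metric, lieForm, frameCoord, e, Matrix.mulVec, dotProduct] <;> ring

theorem gramId_det (A : Matrix (Fin 2) (Fin 2) ℝ) : (gramId A).det = -A.det ^ 2 := by
  simp [gramId, Matrix.det_fin_two]; ring

theorem christoffel_eq (A : Matrix (Fin 2) (Fin 2) ℝ) (hA : A.det ≠ 0) (k i j : Fin 2)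
    {q : ℝ × ℝ} (hq : q ∈ G) :
    christoffel A k i j q = (-∑ l, (gramId A)⁻¹ k l *
      (comp (0, 1) i * gramId A j l + comp (0, 1) j * gramId A i l
        - comp (0, 1) l * gramId A i j)) * q.2⁻¹ := by
  have hy : q.2 ≠ 0 := ne_of_gt hq
  have hg : gram A q = (q.2 ^ 2)⁻¹ • gramId A := by
    ext i j
    simp [gram_apply, mul_comm]
  have hm : IsUnit (gramId A).det := by
    rw [gramId_det]
    simpa using hA
  have hinv : (gram A q)⁻¹ = (q.2 ^ 2) • (gramId A)⁻¹ := by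
    apply Matrix.inv_eq_left_inv
    rw [hg, Matrix.smul_mul, Matrix.mul_smul, smul_smul, Matrix.nonsing_inv_mul _ hm,
      mul_inv_cancel₀ (pow_ne_zero 2 hy), one_smul]
  have hpd : ∀ r s t : Fin 2, pd r (fun p => gram A p s t) q
      = comp (0, 1) r * gramId A s t * (-2 * (q.2 ^ 3)⁻¹) := by
    intro r s t
    have h1 : (fun p => gram A p s t)
        = fun p : ℝ × ℝ => (fun y => gramId A s t * (y ^ 2)⁻¹) p.2 := by
      funext p
      exact gram_apply A p s t
    have h2 : HasDerivAt (fun y : ℝ => gramId A s t * (y ^ 2)⁻¹)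
        (gramId A s t * (-2 * (q.2 ^ 3)⁻¹)) q.2 := by
      refine (((hasDerivAt_pow 2 q.2).fun_inv (pow_ne_zero 2 hy)).const_mul
        (gramId A s t)).congr_deriv ?_
      norm_num
      field_simp
    rw [h1, pd_of_hasDerivAt r _ _ q h2]
    fin_cases r <;> simp [comp]
  rw [christoffel, hinv]
  simp only [hpd, Fin.sum_univ_two, Matrix.smul_apply, smul_eq_mul]
  field_simp
  ring

/-- The sectional curvature is the same at all points and on all bases: it is the constant
`g(X₁) / |A|²`. -/
theorem sectionalCurvature_eq (A : Matrix (Fin 2) (Fin 2) ℝ) (hA : A.det ≠ 0) {q : ℝ × ℝ}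
    (hq : q ∈ G) (v w : ℝ × ℝ) (h : gramDet A q v w ≠ 0) :
    sectionalCurvature A q v w = (A 1 0 ^ 2 - A 0 0 ^ 2) / A.det ^ 2 := by
  have hy : q.2 ≠ 0 := ne_of_gt hq
  have hpd : ∀ r k i j : Fin 2, pd r (christoffel A k i j) q
      = comp (0, 1) r * -(christoffel A k i j q * q.2⁻¹) := by
    intro r k i j
    have h0 : ∀ p ∈ G, christoffel A k i j p = (christoffel A k i j q * q.2) * p.2⁻¹ := by
      intro p hp
      rw [christoffel_eq A hA k i j hp, christoffel_eq A hA k i j hq,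
        inv_mul_cancel_right₀ hy]
    have hG : G ∈ nhds q := (isOpen_lt continuous_const continuous_snd).mem_nhds hq
    have h1 : christoffel A k i j =ᶠ[nhds q]
        fun p : ℝ × ℝ => (fun y => (christoffel A k i j q * q.2) * y⁻¹) p.2 :=
      Filter.eventually_of_mem hG h0
    have h2 := ((hasDerivAt_inv hy).const_mul (christoffel A k i j q * q.2))
    have h3 := pd_of_hasDerivAt r _ _ q h2
    rw [pd, h1.fderiv_eq]
    rw [pd] at h3
    rw [h3]
    fin_cases r <;> simp [comp]
    field_simp
  have hdet : (gramId A)⁻¹ = (-(A.det ^ 2)⁻¹) • (gramId A).adjugate := by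
    rw [Matrix.inv_def, gramId_det, Ring.inverse_eq_inv, inv_neg]
  rw [sectionalCurvature, div_eq_iff h]
  have hA' : A 0 0 * A 1 1 - A 0 1 * A 1 0 ≠ 0 := by rwa [← Matrix.det_fin_two]
  simp only [curv, riemann, hpd, christoffel_eq A hA _ _ _ hq, hdet, gramDet]
  simp [gramId, Matrix.adjugate_fin_two, Matrix.det_fin_two, metric, lieForm, frameCoord, e, comp,
    Matrix.mulVec, dotProduct, Fin.sum_univ_two]
  field_simp
  ring

theorem sectionalCurvature_eq_K (A : Matrix (Fin 2) (Fin 2) ℝ) (hA : A.det ≠ 0) {q : ℝ × ℝ}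
    (hq : q ∈ G) (v w : ℝ × ℝ) (h : gramDet A q v w ≠ 0) :
    sectionalCurvature A q v w = K A := by
  have hId : Id ∈ G := by simp [G, Id]
  have h0 : gramDet A Id (X₁ Id) (X₂ Id) ≠ 0 := by
    have h1 : gramDet A Id (X₁ Id) (X₂ Id) = -A.det ^ 2 := by
      simp [gramDet, metric, lieForm, frameCoord, X₁, X₂, Id, Matrix.det_fin_two, Matrix.mulVec,
        dotProduct]
      ring
    rw [h1]
    simpa using hA
  rw [K, sectionalCurvature_eq A hA hq v w h, sectionalCurvature_eq A hA hId _ _ h0]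

/-! ### The domain `M` -/

/-- `λ₁(x, y) = (c - a) x + (d - b) (y - 1)`. -/
def lam₁ (A : Matrix (Fin 2) (Fin 2) ℝ) (q : ℝ × ℝ) : ℝ :=
  (A 1 0 - A 0 0) * q.1 + (A 1 1 - A 0 1) * (q.2 - 1)

/-- `λ₂(x, y) = (c + a) x + (d + b) (y - 1)`. -/
def lam₂ (A : Matrix (Fin 2) (Fin 2) ℝ) (q : ℝ × ℝ) : ℝ :=
  (A 1 0 + A 0 0) * q.1 + (A 1 1 + A 0 1) * (q.2 - 1)

/-- The point `B = ((d + b) / (c + a), 0)` of the absolute `y = 0`. -/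
def B (A : Matrix (Fin 2) (Fin 2) ℝ) : ℝ × ℝ := ((A 1 1 + A 0 1) / (A 1 0 + A 0 0), 0)

/-- `λ₃(q) = λ₁(q) - λ₁(B)`. -/
def lam₃ (A : Matrix (Fin 2) (Fin 2) ℝ) (q : ℝ × ℝ) : ℝ := lam₁ A q - lam₁ A (B A)

/-- The set `D` (used for `K < 0`). -/
def D (A : Matrix (Fin 2) (Fin 2) ℝ) : Set (ℝ × ℝ) :=
  {q | q ∈ G ∧ lam₁ A q ≤ 0 ∧ 0 ≤ lam₂ A q ∧ 0 < lam₃ A q}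

/-- `M = int D` if `K < 0` and `M = int J⁺(Id)` if `K ≥ 0`. -/
def M (A : Matrix (Fin 2) (Fin 2) ℝ) : Set (ℝ × ℝ) :=
  open Classical in if K A < 0 then interior (D A) else interior (causalFuture A Id)

/-! ### The Lorentzian exponential map

A point of `T*G` is written as `(q, p)`, where `p = (p₁, p₂)` stands for the covector
`p₁ dx + p₂ dy` at `q`. -/

/-- `h_j(q, p) = ⟨p, Y_j(q)⟩`. -/
def mom (A : Matrix (Fin 2) (Fin 2) ℝ) (j : Fin 2) (z : (ℝ × ℝ) × (ℝ × ℝ)) : ℝ :=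
  z.2.1 * (Y A j z.1).1 + z.2.2 * (Y A j z.1).2

/-- The normal Hamiltonian `H = (-h₁² + h₂²) / 2`. -/
def ham (A : Matrix (Fin 2) (Fin 2) ℝ) (z : (ℝ × ℝ) × (ℝ × ℝ)) : ℝ :=
  (-(mom A 0 z) ^ 2 + (mom A 1 z) ^ 2) / 2

/-- The Hamiltonian vector field `(∂H/∂p, -∂H/∂q)` of a function `H` on the cotangent bundle. -/
def hamVec (H : (ℝ × ℝ) × (ℝ × ℝ) → ℝ) (z : (ℝ × ℝ) × (ℝ × ℝ)) : (ℝ × ℝ) × (ℝ × ℝ) :=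
  ((fderiv ℝ H z (0, (1, 0)), fderiv ℝ H z (0, (0, 1))),
    (-fderiv ℝ H z ((1, 0), 0), -fderiv ℝ H z ((0, 1), 0)))

/-- `Γ` is a solution in `T*G` of the normal Hamiltonian system on `[0, T]` that starts at the
covector `p ∈ T*_Id G`. -/
def IsExtremal (A : Matrix (Fin 2) (Fin 2) ℝ) (p : ℝ × ℝ) (T : ℝ)
    (Γ : ℝ → (ℝ × ℝ) × (ℝ × ℝ)) : Prop :=
  0 ≤ T ∧ Γ 0 = (Id, p) ∧ (∀ t ∈ Set.Icc 0 T, (Γ t).1 ∈ G) ∧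
    IsIntegralCurveOn Γ (fun _ => hamVec (ham A)) (Set.Icc 0 T)

/-- The right end `t_max(p) ∈ (0, +∞]` of the maximal interval of existence. -/
def tMax (A : Matrix (Fin 2) (Fin 2) ℝ) (p : ℝ × ℝ) : EReal :=
  ⨆ (T : ℝ) (_ : ∃ Γ, IsExtremal A p T Γ), (T : EReal)

/-- The Lorentzian exponential map `Exp(p, t) = π (e^{t H⃗}(p))`, with the junk value `Id` where
the solution does not exist up to time `t`. -/
def Exp (A : Matrix (Fin 2) (Fin 2) ℝ) (p : ℝ × ℝ) (t : ℝ) : ℝ × ℝ :=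
  open Classical in if h : ∃ Γ, IsExtremal A p t Γ then (h.choose t).1 else Id

/-- The set `C` of initial covectors of arclength-parametrized normal extremals. -/
def C (A : Matrix (Fin 2) (Fin 2) ℝ) : Set (ℝ × ℝ) :=
  {p | ham A (Id, p) = -1 / 2 ∧ mom A 0 (Id, p) < 0}

/-- The parameter domain `N` of the exponential map. -/
def N (A : Matrix (Fin 2) (Fin 2) ℝ) : Set ((ℝ × ℝ) × ℝ) :=
  {s | s.1 ∈ C A ∧ 0 < s.2 ∧ (s.2 : EReal) < tMax A s.1}

/-- The hyperbolic coordinate `ψ` on `C`: the covector at `Id` with `h₁ = -cosh ψ`,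
`h₂ = sinh ψ`, see `mom_covector` and `bijOn_covector`. -/
def covector (A : Matrix (Fin 2) (Fin 2) ℝ) (ψ : ℝ) : ℝ × ℝ :=
  (-A 0 0 * Real.cosh ψ + A 1 0 * Real.sinh ψ, -A 0 1 * Real.cosh ψ + A 1 1 * Real.sinh ψ)

theorem mom_covector (A : Matrix (Fin 2) (Fin 2) ℝ) (hA : A.det ≠ 0) (ψ : ℝ) :
    mom A 0 (Id, covector A ψ) = -Real.cosh ψ ∧ mom A 1 (Id, covector A ψ) = Real.sinh ψ := by
  have hA' : A 0 0 * A 1 1 - A 0 1 * A 1 0 ≠ 0 := by rwa [← Matrix.det_fin_two]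
  have hA2 : A 0 0 * A 1 1 - A 1 0 * A 0 1 ≠ 0 := by rwa [mul_comm (A 1 0)]
  constructor <;>
  · simp [mom, covector, Y, X₁, X₂, Id, Matrix.inv_def, Matrix.adjugate_fin_two,
      Matrix.det_fin_two, Ring.inverse_eq_inv]
    field_simp
    ring

/-- The coordinate `ψ` is a global parametrization of `C`. -/
theorem bijOn_covector (A : Matrix (Fin 2) (Fin 2) ℝ) (hA : A.det ≠ 0) :
    Set.BijOn (covector A) Set.univ (C A) := by
  have hA' : A 0 0 * A 1 1 - A 0 1 * A 1 0 ≠ 0 := by rwa [← Matrix.det_fin_two]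
  refine ⟨fun ψ _ => ⟨?_, ?_⟩, fun ψ _ φ _ h => ?_, fun p hp => ?_⟩
  · rw [ham, (mom_covector A hA ψ).1, (mom_covector A hA ψ).2]
    nlinarith [Real.cosh_sq ψ]
  · rw [(mom_covector A hA ψ).1]
    linarith [Real.cosh_pos ψ]
  · have h1 := (mom_covector A hA ψ).2
    rw [h, (mom_covector A hA φ).2] at h1
    exact (Real.sinh_injective h1).symm
  · obtain ⟨h1, h2⟩ := hp
    refine ⟨Real.arsinh (mom A 1 (Id, p)), Set.mem_univ _, ?_⟩
    have hc : Real.cosh (Real.arsinh (mom A 1 (Id, p))) = -mom A 0 (Id, p) := by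
      rw [Real.cosh_arsinh, Real.sqrt_eq_iff_mul_self_eq (by positivity) (by linarith)]
      rw [ham] at h1
      nlinarith
    rw [covector, hc, Real.sinh_arsinh]
    ext <;>
    · simp [mom, Y, X₁, X₂, Id, Matrix.inv_def, Matrix.adjugate_fin_two,
        Matrix.det_fin_two, Ring.inverse_eq_inv]
      field_simp
      ring

end

end AffLorentz

/-! In the affine coordinates u = -λ₁, v = λ₂ the height is y = 1 + m v - n u with constants m, n
(`slopeV`, `slopeU`), the metric is g = -du dv / y², the future cone is the quadrant du, dv ≥ 0 at
every point, and K = -4mn. So the problem depends only on m and n and can be solved explicitly.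

Put k = mn and let s, c be the sine and cosine of s'' = -k s (`CurvTrig` covers the three signs of k
at once). The unit-speed geodesic with angle ψ is u = e^{-ψ} s / (c + n e^{-ψ} s), v = e^ψ s / (c -
m e^ψ s), and y is the reciprocal of the product of the two denominators. By `geo_unique` and
`isExtremal_geo` this is the only solution, and it lives exactly as long as both denominators stay
positive. By `M_eq`, whatever the sign of K, the set M is given by u, v, y, 1 - n u, 1 + m v > 0.

Let σ = u v / y (`chordSq`). On a geodesic σ = s(t)² and v (1 - n u) / (u (1 + m v)) = e^{2ψ}. Thus
t = arc √σ and ψ are explicit smooth functions on M, and `invExp_geo` and `invExp_spec` show that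
they form a two-sided inverse of Exp. This gives the first two claims.

For maximality, τ = arc √σ is the expected distance from Id. By the inequality of arithmetic and
geometric means (`sqrt_abs_metric_le`), τ grows at least as fast as length along every future curve
ending in M, so such a curve is no longer than τ at its endpoint (`length_le_arc`). A geodesic has
unit speed and τ = t on it, so it attains the bound. -/

namespace AffLorentz

/-! ### Generalized trigonometric functions -/

/-- The generalized sine `s` and cosine `c` solving `s'' = -k s`, together with the inverse `arc`
of `s` on the interval `I` around `[0, ∞) ∩ {c > 0}`. -/
structure CurvTrig (k : ℝ) where
  s : ℝ → ℝ
  c : ℝ → ℝ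
  arc : ℝ → ℝ
  I : Set ℝ
  hasDerivAt_s : ∀ t, HasDerivAt s (c t) t
  hasDerivAt_c : ∀ t, HasDerivAt c (-k * s t) t
  s_zero : s 0 = 0
  c_zero : c 0 = 1
  contDiff_s : ContDiff ℝ ∞ s
  contDiff_c : ContDiff ℝ ∞ c
  isOpen_I : IsOpen I
  Icc_subset : ∀ t ∈ I, Set.Icc 0 t ⊆ I
  s_pos : ∀ t ∈ I, 0 < t → 0 < s t
  c_pos : ∀ t ∈ I, 0 ≤ t → 0 < c t
  -- `I` can only be left when k > 0, through a zero of c at which s > 0. There a denominator of the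
  -- geodesic is negative, which confines its lifetime to `I`.
  exit : ∀ t, 0 ≤ t → t ∉ I → 0 < k ∧ ∃ t₀ ∈ Set.Icc 0 t, c t₀ = 0 ∧ 0 < s t₀
  s_arc : ∀ r, 0 ≤ r → 0 < 1 - k * r ^ 2 → arc r ∈ I ∧ 0 ≤ arc r ∧ s (arc r) = r
  arc_s : ∀ t ∈ I, 0 ≤ t → arc (s t) = t
  contDiffAt_arc : ∀ r, 0 < 1 - k * r ^ 2 → ContDiffAt ℝ ∞ arc r

theorem nonempty_curvTrig_pos {w : ℝ} (hw : 0 < w) : Nonempty (CurvTrig (w ^ 2)) := by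
  have hlin : ∀ t : ℝ, HasDerivAt (fun t => w * t) w t := fun t => by
    simpa using (hasDerivAt_id t).const_mul w
  have hbd : ∀ r : ℝ, 0 < 1 - w ^ 2 * r ^ 2 → -1 < w * r ∧ w * r < 1 := fun r hr => by
    rw [← abs_lt, ← sq_lt_one_iff_abs_lt_one]; nlinarith
  refine ⟨{
    s := fun t => Real.sin (w * t) / w
    c := fun t => Real.cos (w * t)
    arc := fun r => Real.arcsin (w * r) / w
    I := {t | w * t < Real.pi / 2}
    hasDerivAt_s := fun t => ?_
    hasDerivAt_c := fun t => ?_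
    s_zero := by simp
    c_zero := by simp
    contDiff_s := by fun_prop
    contDiff_c := by fun_prop
    isOpen_I := isOpen_lt (by fun_prop) continuous_const
    Icc_subset := fun t ht t' ht' => (mul_le_mul_of_nonneg_left ht'.2 hw.le).trans_lt ht
    s_pos := fun t ht h0 => div_pos (Real.sin_pos_of_pos_of_lt_pi (by positivity)
      (lt_trans ht (by linarith [Real.pi_pos]))) hw
    c_pos := fun t ht h0 => Real.cos_pos_of_mem_Ioo
      ⟨by nlinarith [Real.pi_pos, mul_nonneg hw.le h0], ht⟩
    exit := fun t h0 ht => ⟨by positivity, Real.pi / 2 / w, ⟨by positivity, ?_⟩, ?_, ?_⟩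
    s_arc := fun r h0 hr => ⟨?_, ?_, ?_⟩
    arc_s := fun t ht h0 => ?_
    contDiffAt_arc := fun r hr => ?_ }⟩
  · refine (((Real.hasDerivAt_sin _).comp t (hlin t)).div_const w).congr_deriv ?_
    field_simp
  · refine ((Real.hasDerivAt_cos _).comp t (hlin t)).congr_deriv ?_
    field_simp
  · rw [div_le_iff₀ hw, mul_comm]
    exact not_lt.1 ht
  · rw [mul_div_cancel₀ _ hw.ne', Real.cos_pi_div_two]
  · rw [mul_div_cancel₀ _ hw.ne', Real.sin_pi_div_two]
    positivity
  · change w * (_ / w) < _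
    rw [mul_div_cancel₀ _ hw.ne']
    exact Real.arcsin_lt_pi_div_two.2 (hbd r hr).2
  · exact div_nonneg (Real.arcsin_nonneg.2 (by positivity)) hw.le
  · rw [mul_div_cancel₀ _ hw.ne', Real.sin_arcsin (hbd r hr).1.le (hbd r hr).2.le]
    field_simp
  · have h1 : w * t < Real.pi / 2 := ht
    have h2 : 0 ≤ w * t := by positivity
    rw [mul_div_cancel₀ _ hw.ne', Real.arcsin_sin (by linarith [Real.pi_pos]) h1.le]
    field_simp
  · refine ContDiffAt.div_const (ContDiffAt.comp r
      (Real.contDiffAt_arcsin (hbd r hr).1.ne' (hbd r hr).2.ne) ?_) w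
    fun_prop

theorem nonempty_curvTrig_neg {w : ℝ} (hw : 0 < w) : Nonempty (CurvTrig (-w ^ 2)) := by
  have hlin : ∀ t : ℝ, HasDerivAt (fun t => w * t) w t := fun t => by
    simpa using (hasDerivAt_id t).const_mul w
  refine ⟨{
    s := fun t => Real.sinh (w * t) / w
    c := fun t => Real.cosh (w * t)
    arc := fun r => Real.arsinh (w * r) / w
    I := Set.univ
    hasDerivAt_s := fun t => ?_
    hasDerivAt_c := fun t => ?_
    s_zero := by simp
    c_zero := by simp
    contDiff_s := by fun_prop
    contDiff_c := by fun_prop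
    isOpen_I := isOpen_univ
    Icc_subset := fun t _ => Set.subset_univ _
    s_pos := fun t _ h0 => div_pos (Real.sinh_pos_iff.2 (by positivity)) hw
    c_pos := fun t _ _ => Real.cosh_pos _
    exit := fun t _ ht => absurd (Set.mem_univ t) ht
    s_arc := fun r h0 _ => ⟨Set.mem_univ _,
      div_nonneg (Real.arsinh_nonneg_iff.2 (by positivity)) hw.le, ?_⟩
    arc_s := fun t _ _ => ?_
    contDiffAt_arc := fun r _ => ?_ }⟩
  · refine (((Real.hasDerivAt_sinh _).comp t (hlin t)).div_const w).congr_deriv ?_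
    field_simp
  · refine ((Real.hasDerivAt_cosh _).comp t (hlin t)).congr_deriv ?_
    field_simp
  · rw [mul_div_cancel₀ _ hw.ne', Real.sinh_arsinh]
    field_simp
  · rw [mul_div_cancel₀ _ hw.ne', Real.arsinh_sinh]
    field_simp
  · exact ((Real.contDiff_arsinh.comp (by fun_prop : ContDiff ℝ ∞ fun r => w * r)).div_const
      w).contDiffAt

theorem nonempty_curvTrig (k : ℝ) : Nonempty (CurvTrig k) := by
  rcases lt_trichotomy k 0 with hk | rfl | hk
  · have h := nonempty_curvTrig_neg (Real.sqrt_pos.2 (neg_pos.2 hk))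
    rwa [Real.sq_sqrt (neg_pos.2 hk).le, neg_neg] at h
  · exact ⟨{
      s := id
      c := fun _ => 1
      arc := id
      I := Set.univ
      hasDerivAt_s := hasDerivAt_id
      hasDerivAt_c := fun t => by simpa using hasDerivAt_const t (1 : ℝ)
      s_zero := rfl
      c_zero := rfl
      contDiff_s := contDiff_id
      contDiff_c := contDiff_const
      isOpen_I := isOpen_univ
      Icc_subset := fun t _ => Set.subset_univ _
      s_pos := fun t _ h0 => h0
      c_pos := fun t _ _ => one_pos
      exit := fun t _ ht => absurd (Set.mem_univ t) ht
      s_arc := fun r h0 _ => ⟨Set.mem_univ _, h0, rfl⟩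
      arc_s := fun t _ _ => rfl
      contDiffAt_arc := fun r _ => contDiffAt_id }⟩
  · have h := nonempty_curvTrig_pos (Real.sqrt_pos.2 hk)
    rwa [Real.sq_sqrt hk.le] at h

namespace CurvTrig

variable {k : ℝ} (S : CurvTrig k)

theorem c_sq_add (t : ℝ) : S.c t ^ 2 + k * S.s t ^ 2 = 1 := by
  have h : ∀ t, HasDerivAt (fun t => S.c t ^ 2 + k * S.s t ^ 2) 0 t := fun t => by
    refine (((S.hasDerivAt_c t).pow 2).add (((S.hasDerivAt_s t).pow 2).const_mul k)).congr_deriv ?_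
    norm_num
    ring
  have h1 := is_const_of_deriv_eq_zero (fun t => (h t).differentiableAt) (fun t => (h t).deriv) t 0
  simpa [S.s_zero, S.c_zero] using h1

theorem zero_mem_I : (0 : ℝ) ∈ S.I := by
  obtain ⟨h1, h2, -⟩ := S.s_arc 0 le_rfl (by norm_num)
  exact S.Icc_subset _ h1 ⟨le_rfl, h2⟩

theorem arc_zero : S.arc 0 = 0 := by
  simpa [S.s_zero] using S.arc_s 0 S.zero_mem_I le_rfl

theorem arc_pos {r : ℝ} (h0 : 0 < r) (hr : 0 < 1 - k * r ^ 2) : 0 < S.arc r := by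
  obtain ⟨-, h2, h3⟩ := S.s_arc r h0.le hr
  refine h2.lt_of_ne fun h => h0.ne ?_
  rw [← h3, ← h, S.s_zero]

theorem strictMonoOn_s {t : ℝ} (ht : t ∈ S.I) : StrictMonoOn S.s (Set.Icc 0 t) := by
  refine strictMonoOn_of_deriv_pos (convex_Icc 0 t) S.contDiff_s.continuous.continuousOn ?_
  intro x hx
  have hx' := interior_subset hx
  rw [(S.hasDerivAt_s x).deriv]
  exact S.c_pos x (S.Icc_subset t ht hx') hx'.1

/-- The generalized tangent has derivative 1 / c². Its monotonicity lets the sign of c + l s at an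
endpoint control the sign at all earlier times, see `den_pos_iff`. -/
theorem monotoneOn_s_div_c {t : ℝ} (ht : t ∈ S.I) :
    MonotoneOn (fun x => S.s x / S.c x) (Set.Icc 0 t) := by
  have hc : ∀ x ∈ Set.Icc 0 t, S.c x ≠ 0 := fun x hx =>
    (S.c_pos x (S.Icc_subset t ht hx) hx.1).ne'
  have hd : ∀ x ∈ Set.Icc 0 t, HasDerivAt (fun x => S.s x / S.c x) (1 / S.c x ^ 2) x := by
    intro x hx
    refine ((S.hasDerivAt_s x).div (S.hasDerivAt_c x) (hc x hx)).congr_deriv ?_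
    congr 1
    linear_combination S.c_sq_add x
  refine monotoneOn_of_deriv_nonneg (convex_Icc 0 t)
    (fun x hx => (hd x hx).continuousAt.continuousWithinAt)
    (fun x hx => (hd x (interior_subset hx)).differentiableAt.differentiableWithinAt)
    fun x hx => ?_
  rw [(hd x (interior_subset hx)).deriv]
  positivity

theorem one_sub_pos_of_le {r₁ r₂ : ℝ} (h0 : 0 ≤ r₁) (h : r₁ ≤ r₂) (hr : 0 < 1 - k * r₂ ^ 2) :
    0 < 1 - k * r₁ ^ 2 := by
  have h2 : r₁ ^ 2 ≤ r₂ ^ 2 := pow_le_pow_left₀ h0 h 2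
  rcases le_total k 0 with hk | hk
  · nlinarith [sq_nonneg r₁]
  · nlinarith

theorem arc_mono {r₁ r₂ : ℝ} (h0 : 0 ≤ r₁) (h : r₁ ≤ r₂) (hr : 0 < 1 - k * r₂ ^ 2) :
    S.arc r₁ ≤ S.arc r₂ := by
  obtain ⟨a1, b1, c1⟩ := S.s_arc r₁ h0 (one_sub_pos_of_le h0 h hr)
  obtain ⟨-, b2, c2⟩ := S.s_arc r₂ (h0.trans h) hr
  by_contra! hlt
  have := S.strictMonoOn_s a1 ⟨b2, hlt.le⟩ ⟨b1, le_rfl⟩ hlt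
  rw [c1, c2] at this
  exact this.not_ge h

theorem c_arc {r : ℝ} (h0 : 0 ≤ r) (hr : 0 < 1 - k * r ^ 2) :
    0 < S.c (S.arc r) ∧ S.c (S.arc r) ^ 2 = 1 - k * r ^ 2 := by
  obtain ⟨h1, h2, h3⟩ := S.s_arc r h0 hr
  have h4 := S.c_sq_add (S.arc r)
  rw [h3] at h4
  exact ⟨S.c_pos _ h1 h2, by linarith⟩

theorem hasDerivAt_arc {r : ℝ} (h0 : 0 < r) (hr : 0 < 1 - k * r ^ 2) :
    HasDerivAt S.arc (S.c (S.arc r))⁻¹ r := by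
  have h1 : HasDerivAt S.arc (deriv S.arc r) r :=
    ((S.contDiffAt_arc r hr).differentiableAt (by simp)).hasDerivAt
  have h2 := (S.hasDerivAt_s (S.arc r)).comp r h1
  have h3 : S.s ∘ S.arc =ᶠ[nhds r] id := by
    have ho : IsOpen {r : ℝ | 0 < r ∧ 0 < 1 - k * r ^ 2} :=
      (isOpen_lt continuous_const continuous_id).inter
        (isOpen_lt continuous_const (by fun_prop : Continuous fun r : ℝ => 1 - k * r ^ 2))
    filter_upwards [ho.mem_nhds ⟨h0, hr⟩] with x hx
    exact (S.s_arc x hx.1.le hx.2).2.2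
  have h4 := (h2.congr_of_eventuallyEq h3.symm).unique (hasDerivAt_id r)
  rwa [eq_inv_of_mul_eq_one_right h4] at h1

end CurvTrig

noncomputable section

/-! ### Calculus on a closed interval -/

theorem eq_of_hasDerivWithinAt_zero {f : ℝ → ℝ} {T : ℝ}
    (h : ∀ t ∈ Set.Icc 0 T, HasDerivWithinAt f 0 (Set.Icc 0 T) t) :
    ∀ t ∈ Set.Icc 0 T, f t = f 0 :=
  constant_of_derivWithin_zero (fun t ht => (h t ht).differentiableWithinAt) fun t ht =>
    (h t ⟨ht.1, ht.2.le⟩).derivWithin (uniqueDiffOn_Icc (ht.1.trans_lt ht.2) t ⟨ht.1, ht.2.le⟩)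

theorem hasDerivWithinAt_fst {E F : Type*} [NormedAddCommGroup E] [NormedSpace ℝ E]
    [NormedAddCommGroup F] [NormedSpace ℝ F] {q : ℝ → E × F} {v : E × F} {s : Set ℝ} {t : ℝ}
    (h : HasDerivWithinAt q v s t) : HasDerivWithinAt (fun t => (q t).1) v.1 s t :=
  ((ContinuousLinearMap.fst ℝ E F).hasFDerivAt (x := q t)).comp_hasDerivWithinAt t h

theorem hasDerivWithinAt_snd {E F : Type*} [NormedAddCommGroup E] [NormedSpace ℝ E]
    [NormedAddCommGroup F] [NormedSpace ℝ F] {q : ℝ → E × F} {v : E × F} {s : Set ℝ} {t : ℝ}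
    (h : HasDerivWithinAt q v s t) : HasDerivWithinAt (fun t => (q t).2) v.2 s t :=
  ((ContinuousLinearMap.snd ℝ E F).hasFDerivAt (x := q t)).comp_hasDerivWithinAt t h

/-! ### Explicit solution of the Hamiltonian system in null coordinates -/

section

variable {m n : ℝ} (S : CurvTrig (m * n)) (ψ : ℝ)

/-- The denominator of the first null coordinate of a geodesic. -/
def denU (t : ℝ) : ℝ := S.c t + n * Real.exp (-ψ) * S.s t

/-- The denominator of the second null coordinate of a geodesic. -/
def denV (t : ℝ) : ℝ := S.c t - m * Real.exp ψ * S.s t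

theorem exp_neg_mul_exp : Real.exp (-ψ) * Real.exp ψ = 1 := by
  rw [← Real.exp_add, neg_add_cancel, Real.exp_zero]

theorem denU_zero : denU S ψ 0 = 1 := by simp [denU, S.c_zero, S.s_zero]

theorem denV_zero : denV S ψ 0 = 1 := by simp [denV, S.c_zero, S.s_zero]

/-- The two denominators solve a linear system with constant coefficients; it linearizes the Riccati
equation of the momentum in `geo_unique`. -/
theorem hasDerivAt_denU (t : ℝ) :
    HasDerivAt (denU S ψ) (n * Real.exp (-ψ) * denV S ψ t) t := by
  refine ((S.hasDerivAt_c t).add ((S.hasDerivAt_s t).const_mul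
    (n * Real.exp (-ψ)))).congr_deriv ?_
  rw [denV]
  linear_combination m * n * S.s t * exp_neg_mul_exp ψ

theorem hasDerivAt_denV (t : ℝ) :
    HasDerivAt (denV S ψ) (-m * Real.exp ψ * denU S ψ t) t := by
  refine ((S.hasDerivAt_c t).sub ((S.hasDerivAt_s t).const_mul
    (m * Real.exp ψ))).congr_deriv ?_
  rw [denU]
  linear_combination m * n * S.s t * exp_neg_mul_exp ψ

/-- The first null coordinate of the geodesic with initial hyperbolic angle `ψ`. -/
def geoU (t : ℝ) : ℝ := Real.exp (-ψ) * S.s t / denU S ψ t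

/-- The second null coordinate of the geodesic with initial hyperbolic angle `ψ`. -/
def geoV (t : ℝ) : ℝ := Real.exp ψ * S.s t / denV S ψ t

theorem geoU_zero : geoU S ψ 0 = 0 := by simp [geoU, S.s_zero]

theorem geoV_zero : geoV S ψ 0 = 0 := by simp [geoV, S.s_zero]

variable {S ψ}

theorem hasDerivAt_geoU {t : ℝ} (h : denU S ψ t ≠ 0) :
    HasDerivAt (geoU S ψ) (Real.exp (-ψ) / denU S ψ t ^ 2) t := by
  refine (((S.hasDerivAt_s t).const_mul (Real.exp (-ψ))).div
    (hasDerivAt_denU S ψ t) h).congr_deriv ?_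
  congr 1
  rw [denU, denV]
  linear_combination Real.exp (-ψ) * S.c_sq_add t
    + Real.exp (-ψ) * m * n * S.s t ^ 2 * exp_neg_mul_exp ψ

theorem hasDerivAt_geoV {t : ℝ} (h : denV S ψ t ≠ 0) :
    HasDerivAt (geoV S ψ) (Real.exp ψ / denV S ψ t ^ 2) t := by
  refine (((S.hasDerivAt_s t).const_mul (Real.exp ψ)).div
    (hasDerivAt_denV S ψ t) h).congr_deriv ?_
  congr 1
  rw [denU, denV]
  linear_combination Real.exp ψ * S.c_sq_add t
    + Real.exp ψ * m * n * S.s t ^ 2 * exp_neg_mul_exp ψ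

/-- A form of c² + mn s² = 1. As the left side is the height y, a geodesic with positive
denominators stays in the upper half-plane. -/
theorem geo_height {t : ℝ} (hU : denU S ψ t ≠ 0) (hV : denV S ψ t ≠ 0) :
    1 + m * geoV S ψ t - n * geoU S ψ t = 1 / (denU S ψ t * denV S ψ t) := by
  rw [geoU, geoV]
  field_simp
  rw [denU, denV]
  linear_combination S.c_sq_add t + m * n * S.s t ^ 2 * exp_neg_mul_exp ψ

theorem one_sub_geoU {t : ℝ} (hU : denU S ψ t ≠ 0) :
    1 - n * geoU S ψ t = S.c t / denU S ψ t := by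
  rw [geoU]
  field_simp
  rw [denU]
  ring

theorem one_add_geoV {t : ℝ} (hV : denV S ψ t ≠ 0) :
    1 + m * geoV S ψ t = S.c t / denV S ψ t := by
  rw [geoV]
  field_simp
  rw [denV]
  ring

/-- On `I` both denominators have the form c (1 + l s / c) with c > 0 and s / c increasing from 0,
so positivity at t passes to all earlier times. Leaving `I` requires mn > 0; then m > 0, and at the
zero of c the second denominator is -m e^ψ s < 0. -/
theorem den_pos_iff (hmn : 0 < m * n → 0 < m) {t : ℝ} (ht : 0 ≤ t) :
    (∀ x ∈ Set.Icc 0 t, 0 < denU S ψ x ∧ 0 < denV S ψ x) ↔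
      t ∈ S.I ∧ 0 < denU S ψ t ∧ 0 < denV S ψ t := by
  constructor
  · intro h
    refine ⟨?_, h t ⟨ht, le_rfl⟩⟩
    by_contra hI
    obtain ⟨hk, t₀, h₀, hc, hs⟩ := S.exit t ht hI
    have h1 := (h t₀ h₀).2
    rw [denV, hc] at h1
    have := mul_pos (mul_pos (hmn hk) (Real.exp_pos ψ)) hs
    linarith
  · rintro ⟨hI, hU, hV⟩ x hx
    have hcx := S.c_pos x (S.Icc_subset t hI hx) hx.1
    have hct := S.c_pos t hI ht
    have hm : S.s x / S.c x ≤ S.s t / S.c t :=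
      S.monotoneOn_s_div_c hI hx ⟨ht, le_rfl⟩ hx.2
    have h0 : 0 ≤ S.s x / S.c x := by
      simpa [S.s_zero] using S.monotoneOn_s_div_c hI ⟨le_rfl, ht⟩ hx hx.1
    have key : ∀ l : ℝ, 0 < S.c t + l * S.s t → 0 < S.c x + l * S.s x := by
      intro l hl
      have h1 : 0 < 1 + l * (S.s t / S.c t) := by
        have : 1 + l * (S.s t / S.c t) = (S.c t + l * S.s t) / S.c t := by field_simp
        rw [this]
        positivity
      have h2 : 0 < 1 + l * (S.s x / S.c x) := by
        rcases le_total l 0 with hl0 | hl0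
        · nlinarith
        · positivity
      have h3 : S.c x + l * S.s x = S.c x * (1 + l * (S.s x / S.c x)) := by field_simp
      rw [h3]
      positivity
    refine ⟨key _ hU, ?_⟩
    have := key (-(m * Real.exp ψ)) (by rw [denV] at hV; linarith)
    rw [denV]
    linarith

/-- Any solution of the Hamiltonian system, written in null coordinates, is the explicit one, and
the denominators stay positive on its interval of existence. -/
theorem geo_unique {T : ℝ} {y u v f g : ℝ → ℝ}
    (hyuv : ∀ t, y t = 1 + m * v t - n * u t)
    (hu : ∀ t ∈ Set.Icc 0 T, HasDerivWithinAt u (y t ^ 2 * f t) (Set.Icc 0 T) t)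
    (hv : ∀ t ∈ Set.Icc 0 T, HasDerivWithinAt v (y t ^ 2 * g t) (Set.Icc 0 T) t)
    (hf : ∀ t ∈ Set.Icc 0 T,
      HasDerivWithinAt f (-2 * m * (y t * f t * g t)) (Set.Icc 0 T) t)
    (hg : ∀ t ∈ Set.Icc 0 T,
      HasDerivWithinAt g (2 * n * (y t * f t * g t)) (Set.Icc 0 T) t)
    (hu0 : u 0 = 0) (hv0 : v 0 = 0) (hf0 : f 0 = Real.exp (-ψ)) (hg0 : g 0 = Real.exp ψ) :
    ∀ t ∈ Set.Icc 0 T, (0 < denU S ψ t ∧ 0 < denV S ψ t) ∧ u t = geoU S ψ t ∧ v t = geoV S ψ t := by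
  have hy0 : y 0 = 1 := by rw [hyuv, hu0, hv0]; ring
  have hy' : ∀ t ∈ Set.Icc 0 T, HasDerivWithinAt y
      (m * (y t ^ 2 * g t) - n * (y t ^ 2 * f t)) (Set.Icc 0 T) t := fun t ht => by
    rw [show y = fun t => 1 + m * v t - n * u t from funext hyuv]
    have h := (((hv t ht).const_mul m).const_add 1).sub ((hu t ht).const_mul n)
    rw [hyuv t] at h
    exact h
  have hE : ∀ t, HasDerivWithinAt (denU S ψ) (n * Real.exp (-ψ) * denV S ψ t) (Set.Icc 0 T) t :=
    fun t => (hasDerivAt_denU S ψ t).hasDerivWithinAt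
  have hF : ∀ t, HasDerivWithinAt (denV S ψ) (-m * Real.exp ψ * denU S ψ t) (Set.Icc 0 T) t :=
    fun t => (hasDerivAt_denV S ψ t).hasDerivWithinAt
  -- Conservation of the Hamiltonian, which equals -y² f g / 2.
  have h1 : ∀ t ∈ Set.Icc 0 T, y t ^ 2 * (f t * g t) = 1 := by
    intro t ht
    rw [eq_of_hasDerivWithinAt_zero (f := fun t => y t ^ 2 * (f t * g t)) (fun t ht => ?_) t ht]
    · rw [hy0, hf0, hg0, exp_neg_mul_exp]; norm_num
    · refine (((hy' t ht).pow 2).mul ((hf t ht).mul (hg t ht))).congr_deriv ?_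
      norm_num
      ring
  -- By `h1`, R = y g solves the Riccati equation R' = m R² + n, whose solution should be e^ψ `denU`
  -- / `denV`. The defect w = `denV` R - e^ψ `denU` satisfies w' = m R w, while f' = -2 m R f. So w²
  -- f is constant, hence 0, and no division by `denV` is needed.
  have h2 : ∀ t ∈ Set.Icc 0 T, denV S ψ t * (y t * g t) = Real.exp ψ * denU S ψ t := by
    intro t ht
    have h3 : (denV S ψ t * (y t * g t) - Real.exp ψ * denU S ψ t) ^ 2 * f t = 0 := by
      rw [eq_of_hasDerivWithinAt_zero
        (f := fun t => (denV S ψ t * (y t * g t) - Real.exp ψ * denU S ψ t) ^ 2 * f t)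
        (fun t ht => ?_) t ht]
      · rw [denU_zero, denV_zero, hy0, hg0]; ring
      · refine ((((((hF t).mul ((hy' t ht).mul (hg t ht))).sub
          ((hE t).const_mul (Real.exp ψ)))).pow 2).mul (hf t ht)).congr_deriv ?_
        have e1 := h1 t ht
        have e2 := exp_neg_mul_exp ψ
        norm_num
        linear_combination
          2 * n * f t * (denV S ψ t * (y t * g t) - Real.exp ψ * denU S ψ t) * denV S ψ t * (e1 - e2)
    have h4 : f t ≠ 0 := fun h => by simpa [h] using h1 t ht
    have h5 := (mul_eq_zero.1 h3).resolve_right h4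
    linarith [pow_eq_zero_iff (two_ne_zero) |>.1 h5]
  have h2' : ∀ t ∈ Set.Icc 0 T, denU S ψ t * (y t * f t) = Real.exp (-ψ) * denV S ψ t := by
    intro t ht
    have e1 := h1 t ht
    have hgne : y t * g t ≠ 0 := fun h => by
      rw [show y t ^ 2 * (f t * g t) = y t * g t * (y t * f t) by ring, h] at e1
      norm_num at e1
    apply mul_left_cancel₀ hgne
    linear_combination denU S ψ t * e1 - Real.exp (-ψ) * h2 t ht
      - denU S ψ t * exp_neg_mul_exp ψ
  -- One more first integral. Its value 1 prevents the denominators from vanishing, so they keep the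
  -- sign they have at time 0.
  have h3 : ∀ t ∈ Set.Icc 0 T, y t * (denU S ψ t * denV S ψ t) = 1 := by
    intro t ht
    rw [eq_of_hasDerivWithinAt_zero (f := fun t => y t * (denU S ψ t * denV S ψ t))
      (fun t ht => ?_) t ht]
    · rw [hy0, denU_zero, denV_zero]; norm_num
    · refine ((hy' t ht).mul ((hE t).mul (hF t))).congr_deriv ?_
      norm_num
      linear_combination y t * m * denU S ψ t * h2 t ht - y t * n * denV S ψ t * h2' t ht
  have hEF : ∀ t ∈ Set.Icc 0 T, denU S ψ t ≠ 0 ∧ denV S ψ t ≠ 0 := fun t ht => by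
    have := h3 t ht
    constructor <;> intro h <;> simp [h] at this
  have pos : ∀ d : ℝ → ℝ, (∀ t ∈ Set.Icc 0 T, HasDerivAt d (deriv d t) t) → d 0 = 1 →
      (∀ t ∈ Set.Icc 0 T, d t ≠ 0) → ∀ t ∈ Set.Icc 0 T, 0 < d t := by
    intro d hd hd0 hne t ht
    by_contra! hneg
    have hc : ContinuousOn d (Set.Icc 0 t) := fun x hx =>
      (hd x ⟨hx.1, hx.2.trans ht.2⟩).continuousAt.continuousWithinAt
    obtain ⟨x, hx, hx0⟩ := intermediate_value_Icc' ht.1 hc ⟨hneg, by rw [hd0]; norm_num⟩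
    exact hne x ⟨hx.1, hx.2.trans ht.2⟩ hx0
  have hEp := pos (denU S ψ) (fun t _ => (hasDerivAt_denU S ψ t).differentiableAt.hasDerivAt)
    (denU_zero S ψ) fun t ht => (hEF t ht).1
  have hFp := pos (denV S ψ) (fun t _ => (hasDerivAt_denV S ψ t).differentiableAt.hasDerivAt)
    (denV_zero S ψ) fun t ht => (hEF t ht).2
  intro t ht
  refine ⟨⟨hEp t ht, hFp t ht⟩, ?_, ?_⟩
  · have h := eq_of_hasDerivWithinAt_zero (f := fun t => u t - geoU S ψ t) (fun t ht => ?_) t ht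
    · simpa [hu0, geoU_zero, sub_eq_zero] using h
    · refine ((hu t ht).sub (hasDerivAt_geoU (hEF t ht).1).hasDerivWithinAt).congr_deriv ?_
      rw [sub_eq_zero, eq_div_iff (pow_ne_zero 2 (hEF t ht).1)]
      linear_combination y t * denU S ψ t * h2' t ht + Real.exp (-ψ) * h3 t ht
  · have h := eq_of_hasDerivWithinAt_zero (f := fun t => v t - geoV S ψ t) (fun t ht => ?_) t ht
    · simpa [hv0, geoV_zero, sub_eq_zero] using h
    · refine ((hv t ht).sub (hasDerivAt_geoV (hEF t ht).2).hasDerivWithinAt).congr_deriv ?_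
      rw [sub_eq_zero, eq_div_iff (pow_ne_zero 2 (hEF t ht).2)]
      linear_combination y t * denV S ψ t * h2 t ht + Real.exp ψ * h3 t ht

end

end

noncomputable section

/-! ### Null coordinates on the group -/

variable (A : Matrix (Fin 2) (Fin 2) ℝ)

/-- The first null coordinate `-λ₁`. -/
def nullU (q : ℝ × ℝ) : ℝ := -lam₁ A q

/-- The second null coordinate `λ₂`. -/
def nullV (q : ℝ × ℝ) : ℝ := lam₂ A q

/-- The coefficient of `nullV` in the height `y`. -/
def slopeV : ℝ := (A 0 0 - A 1 0) / (2 * A.det)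

/-- Minus the coefficient of `nullU` in the height `y`. -/
def slopeU : ℝ := (A 0 0 + A 1 0) / (2 * A.det)

/-- The point with given null coordinates. -/
def ofNull (w : ℝ × ℝ) : ℝ × ℝ :=
  (((A 1 1 + A 0 1) * w.1 + (A 1 1 - A 0 1) * w.2) / (2 * A.det),
    1 + slopeV A * w.2 - slopeU A * w.1)

variable {A}

theorem snd_eq (hA : A.det ≠ 0) (q : ℝ × ℝ) :
    q.2 = 1 + slopeV A * nullV A q - slopeU A * nullU A q := by
  have h := Matrix.det_fin_two A
  rw [slopeV, slopeU, nullU, nullV, lam₁, lam₂]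
  field_simp
  rw [h]
  ring

theorem nullU_ofNull (hA : A.det ≠ 0) (w : ℝ × ℝ) : nullU A (ofNull A w) = w.1 := by
  have h := Matrix.det_fin_two A
  simp only [slopeV, slopeU, nullU, ofNull, lam₁]
  field_simp
  rw [h]
  ring

theorem nullV_ofNull (hA : A.det ≠ 0) (w : ℝ × ℝ) : nullV A (ofNull A w) = w.2 := by
  have h := Matrix.det_fin_two A
  simp only [slopeV, slopeU, nullV, ofNull, lam₂]
  field_simp
  rw [h]
  ring

theorem ofNull_null (hA : A.det ≠ 0) (q : ℝ × ℝ) : ofNull A (nullU A q, nullV A q) = q := by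
  refine Prod.ext ?_ (snd_eq hA q).symm
  have h := Matrix.det_fin_two A
  simp only [nullU, nullV, ofNull, lam₁, lam₂]
  field_simp
  rw [h]
  ring

variable (A) in
theorem contDiff_nullU : ContDiff ℝ ∞ (nullU A) := by
  unfold nullU lam₁; fun_prop

variable (A) in
theorem contDiff_nullV : ContDiff ℝ ∞ (nullV A) := by
  unfold nullV lam₂; fun_prop

variable (A) in
theorem contDiff_ofNull : ContDiff ℝ ∞ (ofNull A) := by
  unfold ofNull; fun_prop

/-- Null coordinates as a homeomorphism of the plane. -/
def nullHomeo (hA : A.det ≠ 0) : (ℝ × ℝ) ≃ₜ (ℝ × ℝ) where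
  toFun q := (nullU A q, nullV A q)
  invFun := ofNull A
  left_inv := ofNull_null hA
  right_inv w := Prod.ext (nullU_ofNull hA w) (nullV_ofNull hA w)
  continuous_toFun := (contDiff_nullU A).continuous.prodMk (contDiff_nullV A).continuous
  continuous_invFun := (contDiff_ofNull A).continuous

variable (A) in
/-- The linear part of `nullU`. -/
def dirU (v : ℝ × ℝ) : ℝ := (A 0 0 - A 1 0) * v.1 + (A 0 1 - A 1 1) * v.2

variable (A) in
/-- The linear part of `nullV`. -/
def dirV (v : ℝ × ℝ) : ℝ := (A 1 0 + A 0 0) * v.1 + (A 1 1 + A 0 1) * v.2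

theorem hasDerivWithinAt_nullU {q : ℝ → ℝ × ℝ} {v : ℝ × ℝ} {s : Set ℝ} {t : ℝ}
    (h : HasDerivWithinAt q v s t) :
    HasDerivWithinAt (fun t => nullU A (q t)) (dirU A v) s t := by
  have h1 : HasDerivWithinAt (fun t => (q t).1) v.1 s t :=
    hasDerivWithinAt_fst h
  have h2 : HasDerivWithinAt (fun t => (q t).2) v.2 s t :=
    hasDerivWithinAt_snd h
  unfold nullU lam₁
  refine (((h1.const_mul _).add ((h2.sub_const 1).const_mul _)).neg).congr_deriv ?_
  rw [dirU]
  ring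

theorem hasDerivWithinAt_nullV {q : ℝ → ℝ × ℝ} {v : ℝ × ℝ} {s : Set ℝ} {t : ℝ}
    (h : HasDerivWithinAt q v s t) :
    HasDerivWithinAt (fun t => nullV A (q t)) (dirV A v) s t := by
  have h1 : HasDerivWithinAt (fun t => (q t).1) v.1 s t :=
    hasDerivWithinAt_fst h
  have h2 : HasDerivWithinAt (fun t => (q t).2) v.2 s t :=
    hasDerivWithinAt_snd h
  unfold nullV lam₂
  exact (h1.const_mul _).add ((h2.sub_const 1).const_mul _)

/-- The velocity of the curve with null coordinates `u`, `v`. -/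
theorem hasDerivAt_ofNull (hA : A.det ≠ 0) {u v : ℝ → ℝ} {u' v' t : ℝ} (hu : HasDerivAt u u' t)
    (hv : HasDerivAt v v' t) :
    ∃ w, dirU A w = u' ∧ dirV A w = v' ∧
      HasDerivAt (fun t => ofNull A (u t, v t)) w t := by
  refine ⟨(((A 1 1 + A 0 1) * u' + (A 1 1 - A 0 1) * v') / (2 * A.det),
    slopeV A * v' - slopeU A * u'), ?_, ?_, ?_⟩
  · have h := Matrix.det_fin_two A
    simp only [slopeV, slopeU, dirU]
    field_simp
    rw [h]
    ring
  · have h := Matrix.det_fin_two A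
    simp only [slopeV, slopeU, dirV]
    field_simp
    rw [h]
    ring
  · exact (((hu.const_mul _).add (hv.const_mul _)).div_const _).prodMk
      (((hv.const_mul _).const_add 1).sub (hu.const_mul _))

theorem metric_self (q v : ℝ × ℝ) : metric A q v v = -(dirU A v * dirV A v) / q.2 ^ 2 := by
  simp [metric, lieForm, frameCoord, Matrix.mulVec, dotProduct, dirU, dirV, div_eq_mul_inv]
  ring

theorem metric_Y_zero (hA : A.det ≠ 0) {q : ℝ × ℝ} (hq : q ∈ G) (v : ℝ × ℝ) :
    metric A q v (Y A 0 q) = -(dirU A v + dirV A v) / (2 * q.2) := by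
  have hy : q.2 ≠ 0 := ne_of_gt hq
  have h := Matrix.det_fin_two A
  rw [h] at hA
  simp [metric, lieForm, frameCoord, Matrix.mulVec, dotProduct, dirU, dirV, Y, X₁, X₂,
    Matrix.inv_def, Matrix.adjugate_fin_two, Ring.inverse_eq_inv, h]
  field_simp
  ring

/-- The metric is -u'v' / y², and pairing with Y₁ gives -(u' + v') / (2y). In null coordinates the
future cone is therefore the same quadrant at every point. -/
theorem isFutureNonspacelike_iff (hA : A.det ≠ 0) {q : ℝ × ℝ} (hq : q ∈ G) (v : ℝ × ℝ) :
    IsFutureNonspacelike A q v ↔ 0 ≤ dirU A v ∧ 0 ≤ dirV A v ∧ 0 < dirU A v + dirV A v := by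
  have hy : 0 < q.2 := hq
  rw [IsFutureNonspacelike, metric_self, metric_Y_zero hA hq, neg_div, neg_div, neg_nonpos,
    neg_lt_zero, div_pos_iff_of_pos_right (by positivity), le_div_iff₀ (by positivity), zero_mul]
  constructor
  · rintro ⟨h1, h2⟩
    rcases mul_nonneg_iff.1 h1 with h | h
    · exact ⟨h.1, h.2, h2⟩
    · linarith [h.1, h.2]
  · rintro ⟨h1, h2, h3⟩
    exact ⟨mul_nonneg h1 h2, h3⟩

/-- The parameter mn of the generalized sine is -K / 4: the functions are trigonometric for K < 0
and hyperbolic for K > 0. -/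
theorem K_eq (hA : A.det ≠ 0) : K A = -4 * (slopeV A * slopeU A) := by
  have hId : Id ∈ G := by simp [G, Id]
  have h0 : gramDet A Id (X₁ Id) (X₂ Id) ≠ 0 := by
    have h1 : gramDet A Id (X₁ Id) (X₂ Id) = -A.det ^ 2 := by
      simp [gramDet, metric, lieForm, frameCoord, X₁, X₂, Id, Matrix.det_fin_two, Matrix.mulVec,
        dotProduct]
      ring
    rw [h1]
    simpa using hA
  rw [K, sectionalCurvature_eq A hA hId _ _ h0, slopeV, slopeU]
  field_simp
  ring

/-- The sum of the slopes is a / det A ≥ 0, so two slopes of equal sign are positive. The assumption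
a ≥ 0 serves this purpose. -/
theorem slope_pos (hA : 0 < A.det) (ha : 0 ≤ A 0 0) (h : 0 < slopeV A * slopeU A) :
    0 < slopeV A ∧ 0 < slopeU A := by
  have h1 : 0 ≤ slopeV A + slopeU A := by
    rw [slopeV, slopeU, ← add_div]
    exact div_nonneg (by linarith) (by linarith)
  rcases mul_pos_iff.1 h with h | h
  · exact h
  · linarith [h.1, h.2]

end

noncomputable section

/-! ### The Hamiltonian system in null coordinates -/

variable (A : Matrix (Fin 2) (Fin 2) ℝ)

/-- The null momentum `-(h₁ + h₂)` divided by the height. -/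
def coU (p : ℝ × ℝ) : ℝ := ((A 0 1 - A 1 1) * p.1 + (A 1 0 - A 0 0) * p.2) / A.det

/-- The null momentum `h₂ - h₁` divided by the height. -/
def coV (p : ℝ × ℝ) : ℝ := (-(A 0 1 + A 1 1) * p.1 + (A 0 0 + A 1 0) * p.2) / A.det

variable {A}

theorem ham_eq (hA : A.det ≠ 0) (z : (ℝ × ℝ) × (ℝ × ℝ)) :
    ham A z = -(z.1.2 ^ 2 * (coU A z.2 * coV A z.2)) / 2 := by
  have h := Matrix.det_fin_two A
  rw [h] at hA
  simp [ham, mom, Y, X₁, X₂, Matrix.inv_def, Matrix.adjugate_fin_two, Ring.inverse_eq_inv, coU,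
    coV, h]
  field_simp
  ring

theorem hamVec_ham (hA : A.det ≠ 0) (z : (ℝ × ℝ) × (ℝ × ℝ)) :
    hamVec (ham A) z =
      ((-(z.1.2 ^ 2 * ((A 0 1 - A 1 1) * coV A z.2 - (A 0 1 + A 1 1) * coU A z.2)) / (2 * A.det),
        -(z.1.2 ^ 2 * ((A 1 0 - A 0 0) * coV A z.2 + (A 0 0 + A 1 0) * coU A z.2)) / (2 * A.det)),
        (0, z.1.2 * coU A z.2 * coV A z.2)) := by
  have hy : HasFDerivAt (fun z : (ℝ × ℝ) × (ℝ × ℝ) => z.1.2)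
      ((ContinuousLinearMap.snd ℝ ℝ ℝ).comp (ContinuousLinearMap.fst ℝ (ℝ × ℝ) (ℝ × ℝ))) z :=
    ContinuousLinearMap.hasFDerivAt
      ((ContinuousLinearMap.snd ℝ ℝ ℝ).comp (ContinuousLinearMap.fst ℝ (ℝ × ℝ) (ℝ × ℝ)))
  have h1 : HasFDerivAt (fun z : (ℝ × ℝ) × (ℝ × ℝ) => z.2.1)
      ((ContinuousLinearMap.fst ℝ ℝ ℝ).comp (ContinuousLinearMap.snd ℝ (ℝ × ℝ) (ℝ × ℝ))) z :=
    ContinuousLinearMap.hasFDerivAt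
      ((ContinuousLinearMap.fst ℝ ℝ ℝ).comp (ContinuousLinearMap.snd ℝ (ℝ × ℝ) (ℝ × ℝ)))
  have h2 : HasFDerivAt (fun z : (ℝ × ℝ) × (ℝ × ℝ) => z.2.2)
      ((ContinuousLinearMap.snd ℝ ℝ ℝ).comp (ContinuousLinearMap.snd ℝ (ℝ × ℝ) (ℝ × ℝ))) z :=
    ContinuousLinearMap.hasFDerivAt
      ((ContinuousLinearMap.snd ℝ ℝ ℝ).comp (ContinuousLinearMap.snd ℝ (ℝ × ℝ) (ℝ × ℝ)))
  have hU := ((h1.const_mul (A 0 1 - A 1 1)).add (h2.const_mul (A 1 0 - A 0 0))).mul_const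
    (A.det)⁻¹
  have hV := ((h1.const_mul (-(A 0 1 + A 1 1))).add (h2.const_mul (A 0 0 + A 1 0))).mul_const
    (A.det)⁻¹
  have hH := (((hy.pow 2).mul (hU.mul hV)).neg).mul_const (2 : ℝ)⁻¹
  have hd := hH.congr_of_eventuallyEq (f₁ := ham A)
    (Filter.Eventually.of_forall fun z => by rw [ham_eq hA]; rfl)
  rw [hamVec, hd.fderiv]
  ext
  all_goals simp [coU, coV]
  all_goals field_simp
  all_goals ring

/-- This and the next three lemmas are Hamilton's equations in null coordinates: with f = `coU`, g =
`coV` they read u' = y² f, v' = y² g, f' = -2m y f g, g' = 2n y f g, the system solved in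
`geo_unique`. -/
theorem dirU_hamVec (hA : A.det ≠ 0) (z : (ℝ × ℝ) × (ℝ × ℝ)) :
    dirU A (hamVec (ham A) z).1 = z.1.2 ^ 2 * coU A z.2 := by
  have h := Matrix.det_fin_two A
  rw [hamVec_ham hA, dirU]
  field_simp
  rw [h]
  ring

theorem dirV_hamVec (hA : A.det ≠ 0) (z : (ℝ × ℝ) × (ℝ × ℝ)) :
    dirV A (hamVec (ham A) z).1 = z.1.2 ^ 2 * coV A z.2 := by
  have h := Matrix.det_fin_two A
  rw [hamVec_ham hA, dirV]
  field_simp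
  rw [h]
  ring

theorem coU_hamVec (hA : A.det ≠ 0) (z : (ℝ × ℝ) × (ℝ × ℝ)) :
    coU A (hamVec (ham A) z).2 = -2 * slopeV A * (z.1.2 * coU A z.2 * coV A z.2) := by
  rw [hamVec_ham hA, slopeV]
  generalize coU A z.2 = f
  rw [coU]
  field_simp
  ring

theorem coV_hamVec (hA : A.det ≠ 0) (z : (ℝ × ℝ) × (ℝ × ℝ)) :
    coV A (hamVec (ham A) z).2 = 2 * slopeU A * (z.1.2 * coU A z.2 * coV A z.2) := by
  rw [hamVec_ham hA, slopeU]
  generalize coV A z.2 = f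
  rw [coV]
  field_simp
  ring

theorem coU_covector (hA : A.det ≠ 0) (ψ : ℝ) : coU A (covector A ψ) = Real.exp (-ψ) := by
  have h := Matrix.det_fin_two A
  rw [coU, covector, ← Real.cosh_sub_sinh]
  field_simp
  rw [h]
  ring

theorem coV_covector (hA : A.det ≠ 0) (ψ : ℝ) : coV A (covector A ψ) = Real.exp ψ := by
  have h := Matrix.det_fin_two A
  rw [coV, covector, ← Real.cosh_add_sinh]
  field_simp
  rw [h]
  ring

theorem ext_dir (hA : A.det ≠ 0) {v w : ℝ × ℝ} (hU : dirU A v = dirU A w)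
    (hV : dirV A v = dirV A w) : v = w := by
  have h := Matrix.det_fin_two A
  rw [dirU, dirU] at hU
  rw [dirV, dirV] at hV
  refine Prod.ext (mul_left_cancel₀ hA ?_) (mul_left_cancel₀ hA ?_)
  · rw [h]
    linear_combination (A 1 1 + A 0 1) / 2 * hU - (A 0 1 - A 1 1) / 2 * hV
  · rw [h]
    linear_combination -(A 1 0 + A 0 0) / 2 * hU + (A 0 0 - A 1 0) / 2 * hV

theorem ext_co (hA : A.det ≠ 0) {p r : ℝ × ℝ} (hU : coU A p = coU A r)
    (hV : coV A p = coV A r) : p = r := by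
  have h := Matrix.det_fin_two A
  rw [coU, coU, div_left_inj' hA] at hU
  rw [coV, coV, div_left_inj' hA] at hV
  refine Prod.ext (mul_left_cancel₀ hA ?_) (mul_left_cancel₀ hA ?_)
  · rw [h]
    linear_combination -(A 0 0 + A 1 0) / 2 * hU + (A 1 0 - A 0 0) / 2 * hV
  · rw [h]
    linear_combination -(A 0 1 + A 1 1) / 2 * hU - (A 0 1 - A 1 1) / 2 * hV

theorem nullU_Id : nullU A Id = 0 := by simp [nullU, lam₁, Id]

theorem nullV_Id : nullV A Id = 0 := by simp [nullV, lam₂, Id]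

/-- The covector with given null momenta. -/
def ofCo (A : Matrix (Fin 2) (Fin 2) ℝ) (f g : ℝ) : ℝ × ℝ :=
  (-((A 0 0 + A 1 0) * f + (A 0 0 - A 1 0) * g) / 2,
    -((A 0 1 + A 1 1) * f + (A 0 1 - A 1 1) * g) / 2)

theorem coU_ofCo (hA : A.det ≠ 0) (f g : ℝ) : coU A (ofCo A f g) = f := by
  have h := Matrix.det_fin_two A
  rw [coU, ofCo]
  field_simp
  rw [h]
  ring

theorem coV_ofCo (hA : A.det ≠ 0) (f g : ℝ) : coV A (ofCo A f g) = g := by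
  have h := Matrix.det_fin_two A
  rw [coV, ofCo]
  field_simp
  rw [h]
  ring

variable (S : CurvTrig (slopeV A * slopeU A))

/-- The geodesic with initial hyperbolic angle `ψ`. -/
def geo (ψ t : ℝ) : ℝ × ℝ := ofNull A (geoU S ψ t, geoV S ψ t)

theorem geo_snd {ψ t : ℝ} (hU : denU S ψ t ≠ 0) (hV : denV S ψ t ≠ 0) :
    (geo S ψ t).2 = 1 / (denU S ψ t * denV S ψ t) := geo_height hU hV

theorem hasDerivAt_geo (hA : A.det ≠ 0) {ψ t : ℝ} (hU : denU S ψ t ≠ 0) (hV : denV S ψ t ≠ 0) :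
    ∃ w, dirU A w = Real.exp (-ψ) / denU S ψ t ^ 2 ∧ dirV A w = Real.exp ψ / denV S ψ t ^ 2 ∧
      HasDerivAt (geo S ψ) w t := by
  obtain ⟨w, h1, h2, h3⟩ := hasDerivAt_ofNull hA (hasDerivAt_geoU hU) (hasDerivAt_geoV hV)
  exact ⟨w, h1, h2, h3⟩

theorem isExtremal_geo (hA : A.det ≠ 0) {ψ T : ℝ} (hT : 0 ≤ T)
    (h : ∀ t ∈ Set.Icc 0 T, 0 < denU S ψ t ∧ 0 < denV S ψ t) :
    IsExtremal A (covector A ψ) T fun t =>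
      (geo S ψ t, ofCo A (Real.exp (-ψ) * denV S ψ t ^ 2) (Real.exp ψ * denU S ψ t ^ 2)) := by
  have hId : geo S ψ 0 = Id := by
    rw [geo, geoU_zero, geoV_zero]
    simp [ofNull, Id]
  refine ⟨hT, Prod.ext hId ?_, fun t ht => ?_, fun t ht => ?_⟩
  · refine ext_co hA ?_ ?_
    · simp [coU_ofCo hA, denV_zero, coU_covector hA]
    · simp [coV_ofCo hA, denU_zero, coV_covector hA]
  · obtain ⟨hU, hV⟩ := h t ht
    change 0 < (geo S ψ t).2
    rw [geo_snd S hU.ne' hV.ne']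
    positivity
  · obtain ⟨hU, hV⟩ := h t ht
    obtain ⟨w, h1, h2, h3⟩ := hasDerivAt_geo S hA hU.ne' hV.ne'
    have hf : HasDerivAt (fun t => Real.exp (-ψ) * denV S ψ t ^ 2)
        (-2 * slopeV A * (denU S ψ t * denV S ψ t)) t := by
      refine (((hasDerivAt_denV S ψ t).pow 2).const_mul _).congr_deriv ?_
      norm_num
      linear_combination 2 * slopeV A * (denU S ψ t * denV S ψ t) * exp_neg_mul_exp ψ
    have hg : HasDerivAt (fun t => Real.exp ψ * denU S ψ t ^ 2)
        (2 * slopeU A * (denU S ψ t * denV S ψ t)) t := by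
      refine (((hasDerivAt_denU S ψ t).pow 2).const_mul _).congr_deriv ?_
      norm_num
      linear_combination 2 * slopeU A * (denU S ψ t * denV S ψ t) * exp_neg_mul_exp ψ
    have hp : HasDerivAt
        (fun t => ofCo A (Real.exp (-ψ) * denV S ψ t ^ 2) (Real.exp ψ * denU S ψ t ^ 2))
        (ofCo A (-2 * slopeV A * (denU S ψ t * denV S ψ t))
          (2 * slopeU A * (denU S ψ t * denV S ψ t))) t :=
      (((hf.const_mul _).add (hg.const_mul _)).neg.div_const 2).prodMk
        (((hf.const_mul _).add (hg.const_mul _)).neg.div_const 2)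
    have e0 := geo_snd S hU.ne' hV.ne'
    refine ((h3.prodMk hp).congr_deriv (Prod.ext (ext_dir hA ?_ ?_)
      (ext_co hA ?_ ?_))).hasDerivWithinAt
    · rw [dirU_hamVec hA, h1, coU_ofCo hA, e0]
      field_simp
    · rw [dirV_hamVec hA, h2, coV_ofCo hA, e0]
      field_simp
    · rw [coU_hamVec hA, coU_ofCo hA, coU_ofCo hA, coV_ofCo hA, e0]
      field_simp
      linear_combination slopeV A * exp_neg_mul_exp ψ
    · rw [coV_hamVec hA, coV_ofCo hA, coU_ofCo hA, coV_ofCo hA, e0]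
      field_simp
      linear_combination -slopeU A * exp_neg_mul_exp ψ

theorem IsExtremal.eq_geo (hA : A.det ≠ 0) {ψ T : ℝ} {Γ : ℝ → (ℝ × ℝ) × (ℝ × ℝ)}
    (h : IsExtremal A (covector A ψ) T Γ) :
    ∀ t ∈ Set.Icc 0 T, (0 < denU S ψ t ∧ 0 < denV S ψ t) ∧ (Γ t).1 = geo S ψ t := by
  obtain ⟨-, h0, -, hΓ⟩ := h
  have hq : ∀ t ∈ Set.Icc 0 T, HasDerivWithinAt (fun t => (Γ t).1) (hamVec (ham A) (Γ t)).1
      (Set.Icc 0 T) t := fun t ht => hasDerivWithinAt_fst (hΓ t ht)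
  have hp1 : ∀ t ∈ Set.Icc 0 T, HasDerivWithinAt (fun t => (Γ t).2.1)
      (hamVec (ham A) (Γ t)).2.1 (Set.Icc 0 T) t := fun t ht =>
    hasDerivWithinAt_fst (hasDerivWithinAt_snd (hΓ t ht))
  have hp2 : ∀ t ∈ Set.Icc 0 T, HasDerivWithinAt (fun t => (Γ t).2.2)
      (hamVec (ham A) (Γ t)).2.2 (Set.Icc 0 T) t := fun t ht =>
    hasDerivWithinAt_snd (hasDerivWithinAt_snd (hΓ t ht))
  have key := geo_unique (S := S) (ψ := ψ) (T := T) (y := fun t => (Γ t).1.2)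
    (u := fun t => nullU A (Γ t).1) (v := fun t => nullV A (Γ t).1)
    (f := fun t => coU A (Γ t).2) (g := fun t => coV A (Γ t).2) (fun t => snd_eq hA _)
    (fun t ht => (hasDerivWithinAt_nullU (hq t ht)).congr_deriv (dirU_hamVec hA _))
    (fun t ht => (hasDerivWithinAt_nullV (hq t ht)).congr_deriv (dirV_hamVec hA _))
    (fun t ht => HasDerivWithinAt.congr_deriv
      (((((hp1 t ht).const_mul _).add ((hp2 t ht).const_mul _)).div_const _)) (coU_hamVec hA _))
    (fun t ht => HasDerivWithinAt.congr_deriv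
      (((((hp1 t ht).const_mul _).add ((hp2 t ht).const_mul _)).div_const _)) (coV_hamVec hA _))
    (by simp [h0, nullU_Id]) (by simp [h0, nullV_Id]) (by simp [h0, coU_covector hA])
    (by simp [h0, coV_covector hA])
  intro t ht
  obtain ⟨h1, h2, h3⟩ := key t ht
  exact ⟨h1, by rw [geo, ← h2, ← h3, ofNull_null hA]⟩

theorem Exp_eq_geo (hA : A.det ≠ 0) {ψ t : ℝ} (ht : 0 ≤ t)
    (h : ∀ x ∈ Set.Icc 0 t, 0 < denU S ψ x ∧ 0 < denV S ψ x) :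
    Exp A (covector A ψ) t = geo S ψ t := by
  have hex : ∃ Γ, IsExtremal A (covector A ψ) t Γ := ⟨_, isExtremal_geo S hA ht h⟩
  rw [Exp, dif_pos hex]
  exact (hex.choose_spec.eq_geo S hA t ⟨ht, le_rfl⟩).2

theorem lt_tMax_iff (hA : A.det ≠ 0) {ψ t : ℝ} (ht : 0 ≤ t) :
    (t : EReal) < tMax A (covector A ψ) ↔
      ∀ x ∈ Set.Icc 0 t, 0 < denU S ψ x ∧ 0 < denV S ψ x := by
  constructor
  · intro h
    obtain ⟨T, hT⟩ := lt_iSup_iff.1 h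
    obtain ⟨⟨Γ, hΓ⟩, hlt⟩ := lt_iSup_iff.1 hT
    intro x hx
    exact (hΓ.eq_geo S hA x ⟨hx.1, hx.2.trans (EReal.coe_lt_coe_iff.1 hlt).le⟩).1
  · intro h
    have hc : Continuous (denU S ψ) ∧ Continuous (denV S ψ) :=
      ⟨continuous_iff_continuousAt.2 fun x => (hasDerivAt_denU S ψ x).continuousAt,
        continuous_iff_continuousAt.2 fun x => (hasDerivAt_denV S ψ x).continuousAt⟩
    have ho : IsOpen {x | 0 < denU S ψ x ∧ 0 < denV S ψ x} :=
      (isOpen_lt continuous_const hc.1).inter (isOpen_lt continuous_const hc.2)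
    -- `tMax` is a supremum, so the strict inequality needs an extremal living slightly beyond t.
    obtain ⟨ε, hε, hb⟩ := Metric.isOpen_iff.1 ho t (h t ⟨ht, le_rfl⟩)
    have hT : (∃ Γ, IsExtremal A (covector A ψ) (t + ε / 2) Γ) := by
      refine ⟨_, isExtremal_geo S hA (by positivity) fun x hx => ?_⟩
      rcases le_total x t with hxt | hxt
      · exact h x ⟨hx.1, hxt⟩
      · refine hb ?_
        rw [Metric.mem_ball, Real.dist_eq, abs_of_nonneg (by linarith)]
        linarith [hx.2]
    refine lt_of_lt_of_le (b := ((t + ε / 2 : ℝ) : EReal)) ?_ ?_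
    · exact EReal.coe_lt_coe_iff.2 (by linarith)
    · exact le_iSup₂_of_le (t + ε / 2) hT le_rfl

theorem covector_mem_N (hA : A.det ≠ 0) (hm : 0 < slopeV A * slopeU A → 0 < slopeV A) {ψ t : ℝ} :
    (covector A ψ, t) ∈ N A ↔ 0 < t ∧ t ∈ S.I ∧ 0 < denU S ψ t ∧ 0 < denV S ψ t := by
  have hC : covector A ψ ∈ C A := (bijOn_covector A hA).mapsTo (Set.mem_univ ψ)
  constructor
  · rintro ⟨-, h0, h⟩
    exact ⟨h0, (den_pos_iff hm h0.le).1 ((lt_tMax_iff S hA h0.le).1 h)⟩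
  · rintro ⟨h0, h⟩
    exact ⟨hC, h0, (lt_tMax_iff S hA h0.le).2 ((den_pos_iff hm h0.le).2 h)⟩

end

noncomputable section

/-! ### Monotonicity of null coordinates along future curves -/

theorem monotoneOn_of_lipschitzOnWith_of_ae_deriv_nonneg {f : ℝ → ℝ} {L : NNReal} {a b : ℝ}
    (hf : LipschitzOnWith L f (Set.Icc a b))
    (h : ∀ᵐ t ∂(MeasureTheory.volume.restrict (Set.Icc a b)), 0 ≤ deriv f t) :
    MonotoneOn f (Set.Icc a b) := by
  intro x hx y hy hxy
  have hsub : Set.Icc x y ⊆ Set.Icc a b := Set.Icc_subset_Icc hx.1 hy.2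
  have hac : AbsolutelyContinuousOnInterval f x y := by
    refine LipschitzOnWith.absolutelyContinuousOnInterval (K := L) (hf.mono ?_)
    rwa [Set.uIcc_of_le hxy]
  have h1 := hac.integral_deriv_eq_sub
  have h2 := intervalIntegral.integral_nonneg_of_ae_restrict hxy
    (MeasureTheory.ae_restrict_of_ae_restrict_of_subset hsub h)
  linarith

theorem lipschitzWith_affine (α β γ : ℝ) :
    LipschitzWith (‖α‖₊ + ‖β‖₊) fun q : ℝ × ℝ => α * q.1 + β * q.2 + γ := by
  refine LipschitzWith.of_dist_le_mul fun p q => ?_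
  rw [Real.dist_eq, show α * p.1 + β * p.2 + γ - (α * q.1 + β * q.2 + γ)
    = α * (p.1 - q.1) + β * (p.2 - q.2) by ring]
  have h1 : |p.1 - q.1| ≤ dist p q := by
    rw [← Real.dist_eq]; exact le_max_left _ _
  have h2 : |p.2 - q.2| ≤ dist p q := by
    rw [← Real.dist_eq]; exact le_max_right _ _
  calc _ ≤ |α| * |p.1 - q.1| + |β| * |p.2 - q.2| := by
        rw [← abs_mul, ← abs_mul]; exact abs_add_le _ _
    _ ≤ |α| * dist p q + |β| * dist p q := by gcongr
    _ = _ := by rw [NNReal.coe_add, coe_nnnorm, coe_nnnorm, Real.norm_eq_abs, Real.norm_eq_abs]; ring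

variable {A : Matrix (Fin 2) (Fin 2) ℝ}

theorem IsFutureCurve.ae_deriv (hA : A.det ≠ 0) {T : ℝ} {q : ℝ → ℝ × ℝ}
    (h : IsFutureCurve A T q) :
    ∀ᵐ t ∂(MeasureTheory.volume.restrict (Set.Icc 0 T)),
      HasDerivAt q (deriv q t) t ∧ 0 ≤ dirU A (deriv q t) ∧ 0 ≤ dirV A (deriv q t) := by
  filter_upwards [h.2.2.2, MeasureTheory.ae_restrict_mem measurableSet_Icc] with t ht hmem
  have h1 := (isFutureNonspacelike_iff hA (h.2.1 t hmem) _).1 ht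
  refine ⟨?_, h1.1, h1.2.1⟩
  -- Where q is not differentiable `deriv` is 0, which the strict inequality in the cone condition
  -- excludes.
  by_contra hd
  have h0 : deriv q t = 0 := deriv_zero_of_not_differentiableAt fun hd' => hd hd'.hasDerivAt
  rw [h0] at h1
  simp [dirU, dirV] at h1

theorem hasDerivAt_nullU {q : ℝ → ℝ × ℝ} {v : ℝ × ℝ} {t : ℝ} (h : HasDerivAt q v t) :
    HasDerivAt (fun t => nullU A (q t)) (dirU A v) t :=
  hasDerivWithinAt_univ.1 (hasDerivWithinAt_nullU h.hasDerivWithinAt)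

theorem hasDerivAt_nullV {q : ℝ → ℝ × ℝ} {v : ℝ × ℝ} {t : ℝ} (h : HasDerivAt q v t) :
    HasDerivAt (fun t => nullV A (q t)) (dirV A v) t :=
  hasDerivWithinAt_univ.1 (hasDerivWithinAt_nullV h.hasDerivWithinAt)

theorem IsFutureCurve.monotoneOn_nullU (hA : A.det ≠ 0) {T : ℝ} {q : ℝ → ℝ × ℝ}
    (h : IsFutureCurve A T q) : MonotoneOn (fun t => nullU A (q t)) (Set.Icc 0 T) := by
  obtain ⟨L, hL⟩ := h.2.2.1
  have h1 := (lipschitzWith_affine (A 0 0 - A 1 0) (A 0 1 - A 1 1)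
    (A 1 1 - A 0 1)).comp_lipschitzOnWith hL
  have h2 : (fun t => nullU A (q t)) = (fun q : ℝ × ℝ => (A 0 0 - A 1 0) * q.1
      + (A 0 1 - A 1 1) * q.2 + (A 1 1 - A 0 1)) ∘ q := by
    funext t
    simp only [nullU, lam₁, Function.comp]
    ring
  rw [← h2] at h1
  refine monotoneOn_of_lipschitzOnWith_of_ae_deriv_nonneg h1 ?_
  filter_upwards [h.ae_deriv hA] with t ht
  rw [(hasDerivAt_nullU ht.1).deriv]
  exact ht.2.1

theorem IsFutureCurve.monotoneOn_nullV (hA : A.det ≠ 0) {T : ℝ} {q : ℝ → ℝ × ℝ}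
    (h : IsFutureCurve A T q) : MonotoneOn (fun t => nullV A (q t)) (Set.Icc 0 T) := by
  obtain ⟨L, hL⟩ := h.2.2.1
  have h1 := (lipschitzWith_affine (A 1 0 + A 0 0) (A 1 1 + A 0 1)
    (-(A 1 1 + A 0 1))).comp_lipschitzOnWith hL
  have h2 : (fun t => nullV A (q t)) = (fun q : ℝ × ℝ => (A 1 0 + A 0 0) * q.1
      + (A 1 1 + A 0 1) * q.2 + -(A 1 1 + A 0 1)) ∘ q := by
    funext t
    simp only [nullV, lam₂, Function.comp]
    ring
  rw [← h2] at h1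
  refine monotoneOn_of_lipschitzOnWith_of_ae_deriv_nonneg h1 ?_
  filter_upwards [h.ae_deriv hA] with t ht
  rw [(hasDerivAt_nullV ht.1).deriv]
  exact ht.2.2

/-! ### The causal future and the domain `M` -/

/-- Null coordinates do not decrease along future curves. Conversely, the cone is constant in these
affine coordinates and G is convex, so the straight segment from Id is a future curve. -/
theorem causalFuture_Id (hA : A.det ≠ 0) :
    causalFuture A Id = {q | q ∈ G ∧ 0 ≤ nullU A q ∧ 0 ≤ nullV A q} := by
  ext q₁
  constructor
  · rintro ⟨T, q, hq, h0, rfl⟩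
    have hT : (0 : ℝ) ∈ Set.Icc 0 T := ⟨le_rfl, hq.1⟩
    have hT' : T ∈ Set.Icc 0 T := ⟨hq.1, le_rfl⟩
    refine ⟨hq.2.1 T hT', ?_, ?_⟩
    · have := hq.monotoneOn_nullU hA hT hT' hq.1
      simpa [h0, nullU_Id] using this
    · have := hq.monotoneOn_nullV hA hT hT' hq.1
      simpa [h0, nullV_Id] using this
  · rintro ⟨hG, hU, hV⟩
    have hId : Id ∈ G := by simp [G, Id]
    rcases eq_or_ne q₁ Id with rfl | hne
    -- With T = 0 the almost everywhere condition is void, so a constant curve is admitted.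
    · refine ⟨0, fun _ => Id, ⟨le_rfl, fun _ _ => hId, ⟨0, LipschitzWith.const _ |>.lipschitzOnWith⟩,
        ?_⟩, rfl, rfl⟩
      simp
    · have hd : ∀ t, HasDerivAt (fun t : ℝ => Id + t • (q₁ - Id)) (q₁ - Id) t := fun t => by
        simpa using ((hasDerivAt_id t).smul_const (q₁ - Id)).const_add Id
      have hG' : ∀ t ∈ Set.Icc (0 : ℝ) 1, Id + t • (q₁ - Id) ∈ G := by
        intro t ht
        have h1 : (0 : ℝ) < q₁.2 := hG
        change 0 < Id.2 + t * (q₁.2 - Id.2)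
        have : Id.2 = (1 : ℝ) := rfl
        rw [this]
        rcases ht.1.eq_or_lt with rfl | h
        · norm_num
        · nlinarith [mul_pos h h1, ht.2]
      refine ⟨1, fun t => Id + t • (q₁ - Id), ⟨zero_le_one, hG',
        ⟨‖q₁ - Id‖₊, LipschitzWith.lipschitzOnWith ?_⟩, ?_⟩, by simp, by simp⟩
      · exact lipschitzWith_of_nnnorm_deriv_le (fun t => (hd t).differentiableAt)
          fun t => by rw [(hd t).deriv]
      · filter_upwards [MeasureTheory.ae_restrict_mem measurableSet_Icc] with t ht
        rw [isFutureNonspacelike_iff hA (hG' t ht), (hd t).deriv]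
        have e1 : dirU A (q₁ - Id) = nullU A q₁ := by
          simp [dirU, nullU, lam₁, Id]; ring
        have e2 : dirV A (q₁ - Id) = nullV A q₁ := by
          simp [dirV, nullV, lam₂, Id]
        rw [e1, e2]
        refine ⟨hU, hV, lt_of_le_of_ne (add_nonneg hU hV) fun h => hne ?_⟩
        have h1 : nullU A q₁ = 0 := by linarith
        have h2 : nullV A q₁ = 0 := by linarith
        rw [← ofNull_null hA q₁, ← ofNull_null hA Id, h1, h2, nullU_Id, nullV_Id]

theorem interior_null_quadrant (hA : A.det ≠ 0) :
    interior {q | 0 ≤ nullU A q ∧ 0 ≤ nullV A q} = {q | 0 < nullU A q ∧ 0 < nullV A q} := by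
  have h := (nullHomeo hA).preimage_interior (Set.Ici 0 ×ˢ Set.Ici 0)
  rw [interior_prod_eq, interior_Ici] at h
  exact h.symm

theorem lam₃_eq (h : A 1 0 + A 0 0 ≠ 0) (hA : A.det ≠ 0) (q : ℝ × ℝ) :
    lam₃ A q = (1 - slopeU A * nullU A q) / slopeU A := by
  have hd := Matrix.det_fin_two A
  have h' : A 0 0 + A 1 0 ≠ 0 := by rwa [add_comm]
  simp only [lam₃, lam₁, B, slopeU, nullU]
  field_simp
  rw [hd]
  ring

/-- One description for all signs of K. For K < 0 the condition λ₃ > 0 is 1 - n u > 0, and 1 + m v >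
0 is automatic since m > 0. For K ≥ 0 both conditions follow from y > 0. -/
theorem M_eq (hA : 0 < A.det) (ha : 0 ≤ A 0 0) :
    M A = {q | 0 < nullU A q ∧ 0 < nullV A q ∧ 0 < q.2 ∧ 0 < 1 - slopeU A * nullU A q ∧
      0 < 1 + slopeV A * nullV A q} := by
  have hA' := hA.ne'
  have hcU : Continuous (nullU A) := (contDiff_nullU A).continuous
  rw [M, K_eq hA']
  split_ifs with hK
  · obtain ⟨hm, hn⟩ := slope_pos hA ha (by linarith)
    have hne : A 1 0 + A 0 0 ≠ 0 := fun h => by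
      rw [slopeU, add_comm, h, zero_div] at hn
      exact hn.false
    have hD : D A = {q | 0 ≤ nullU A q ∧ 0 ≤ nullV A q} ∩ ({q | 0 < q.2} ∩
        {q | 0 < 1 - slopeU A * nullU A q}) := by
      ext q
      simp only [D, lam₃_eq hne hA', div_pos_iff_of_pos_right hn, nullU, nullV, G,
        Set.mem_ofPred_eq, Set.mem_inter_iff, Left.nonneg_neg_iff]
      tauto
    have ho : IsOpen ({q : ℝ × ℝ | 0 < q.2} ∩ {q | 0 < 1 - slopeU A * nullU A q}) :=
      (isOpen_lt continuous_const continuous_snd).inter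
        (isOpen_lt continuous_const (by fun_prop))
    rw [hD, interior_inter, interior_null_quadrant hA', ho.interior_eq]
    ext q
    constructor
    · rintro ⟨⟨h1, h2⟩, h3, h4⟩
      exact ⟨h1, h2, h3, h4, by positivity⟩
    · rintro ⟨h1, h2, h3, h4, -⟩
      exact ⟨⟨h1, h2⟩, h3, h4⟩
  · have hJ : causalFuture A Id = {q | 0 ≤ nullU A q ∧ 0 ≤ nullV A q} ∩ {q | 0 < q.2} := by
      rw [causalFuture_Id hA']
      ext q
      exact and_comm
    have ho : IsOpen {q : ℝ × ℝ | 0 < q.2} := isOpen_lt continuous_const continuous_snd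
    rw [hJ, interior_inter, interior_null_quadrant hA', ho.interior_eq]
    ext q
    constructor
    · rintro ⟨⟨h1, h2⟩, h3⟩
      have h3' : 0 < q.2 := h3
      refine ⟨h1, h2, h3, ?_⟩
      rw [snd_eq hA' q] at h3'
      -- Here mn ≤ 0. For m ≤ 0 ≤ n both factors are at least y, for n ≤ 0 ≤ m both are at least 1,
      -- and for equal signs one slope is zero.
      rcases le_total (slopeV A) 0 with hm | hm <;> rcases le_total (slopeU A) 0 with hn | hn
      · rcases hm.eq_or_lt with hm0 | hm0
        · rw [hm0] at h3' ⊢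
          constructor <;> nlinarith
        · have : slopeU A = 0 := by nlinarith
          rw [this] at h3' ⊢
          constructor <;> nlinarith
      · constructor <;> nlinarith
      · constructor <;> nlinarith
      · rcases hm.eq_or_lt with hm0 | hm0
        · rw [← hm0] at h3' ⊢
          constructor <;> nlinarith
        · have : slopeU A = 0 := by nlinarith
          rw [this] at h3' ⊢
          constructor <;> nlinarith
    · rintro ⟨h1, h2, h3, -⟩
      exact ⟨⟨h1, h2⟩, h3⟩

end

noncomputable section

/-! ### The exponential map is a diffeomorphism -/

variable {A : Matrix (Fin 2) (Fin 2) ℝ}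

variable (A) in
/-- The squared chordal distance from the identity. -/
def chordSq (q : ℝ × ℝ) : ℝ := nullU A q * nullV A q / q.2

/-- The value of c² at τ = arc √σ. The factorization shows that on M the number √σ lies in the
domain of arc. -/
theorem one_sub_chordSq (hA : A.det ≠ 0) {q : ℝ × ℝ} (hq : q.2 ≠ 0) :
    1 - slopeV A * slopeU A * chordSq A q =
      (1 - slopeU A * nullU A q) * (1 + slopeV A * nullV A q) / q.2 := by
  rw [chordSq, eq_div_iff hq, sub_mul, mul_assoc, div_mul_cancel₀ _ hq, snd_eq hA q]
  ring

variable (S : CurvTrig (slopeV A * slopeU A))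

/-- The inverse of the exponential map. -/
def invExp (q : ℝ × ℝ) : ℝ × ℝ :=
  (Real.log (nullV A q * (1 - slopeU A * nullU A q) /
      (nullU A q * (1 + slopeV A * nullV A q))) / 2,
    S.arc (Real.sqrt (chordSq A q)))

theorem chordSq_geo (hA : A.det ≠ 0) {ψ t : ℝ} (hU : denU S ψ t ≠ 0) (hV : denV S ψ t ≠ 0) :
    chordSq A (geo S ψ t) = S.s t ^ 2 := by
  rw [chordSq, geo_snd S hU hV, geo, nullU_ofNull hA, nullV_ofNull hA, geoU, geoV]
  field_simp
  linear_combination S.s t ^ 2 * exp_neg_mul_exp ψ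

theorem geo_mem (hA : 0 < A.det) (ha : 0 ≤ A 0 0) {ψ t : ℝ} (h0 : 0 < t) (hI : t ∈ S.I)
    (hU : 0 < denU S ψ t) (hV : 0 < denV S ψ t) : geo S ψ t ∈ M A := by
  have hs := S.s_pos t hI h0
  have hc := S.c_pos t hI h0.le
  have e1 : nullU A (geo S ψ t) = geoU S ψ t := nullU_ofNull hA.ne' _
  have e2 : nullV A (geo S ψ t) = geoV S ψ t := nullV_ofNull hA.ne' _
  rw [M_eq hA ha]
  refine ⟨?_, ?_, ?_, ?_, ?_⟩
  · rw [e1, geoU]; positivity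
  · rw [e2, geoV]; positivity
  · rw [geo_snd S hU.ne' hV.ne']; positivity
  · rw [e1, one_sub_geoU hU.ne']; positivity
  · rw [e2, one_add_geoV hV.ne']; positivity

theorem invExp_geo (hA : A.det ≠ 0) {ψ t : ℝ} (h0 : 0 < t) (hI : t ∈ S.I)
    (hU : 0 < denU S ψ t) (hV : 0 < denV S ψ t) : invExp S (geo S ψ t) = (ψ, t) := by
  have hs := S.s_pos t hI h0
  have hc := S.c_pos t hI h0.le
  have e1 : nullU A (geo S ψ t) = geoU S ψ t := nullU_ofNull hA _
  have e2 : nullV A (geo S ψ t) = geoV S ψ t := nullV_ofNull hA _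
  refine Prod.ext ?_ ?_
  · rw [invExp, e1, e2, one_sub_geoU hU.ne', one_add_geoV hV.ne', geoU, geoV]
    have h : Real.exp ψ * S.s t / denV S ψ t * (S.c t / denU S ψ t) /
        (Real.exp (-ψ) * S.s t / denU S ψ t * (S.c t / denV S ψ t)) = Real.exp (2 * ψ) := by
      rw [show 2 * ψ = ψ - -ψ by ring, Real.exp_sub]
      field_simp
    rw [h, Real.log_exp]
    ring
  · rw [invExp, chordSq_geo S hA hU.ne' hV.ne', Real.sqrt_sq hs.le, S.arc_s t hI h0.le]

/-- With P = 1 - n u and Q = 1 + m v, the known values s² = uv / y, c² = PQ / y and e^{2ψ} = vP /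
(uQ) give e^{-ψ} s = u c / P and e^ψ s = v c / Q. The denominators are then c / P and c / Q, and the
quotients return u and v. -/
theorem invExp_spec (hA : A.det ≠ 0) {q : ℝ × ℝ} (hu : 0 < nullU A q) (hv : 0 < nullV A q)
    (hy : 0 < q.2) (hP : 0 < 1 - slopeU A * nullU A q) (hQ : 0 < 1 + slopeV A * nullV A q) :
    (0 < (invExp S q).2 ∧ (invExp S q).2 ∈ S.I ∧ 0 < denU S (invExp S q).1 (invExp S q).2 ∧
      0 < denV S (invExp S q).1 (invExp S q).2) ∧ geo S (invExp S q).1 (invExp S q).2 = q := by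
  have hσ : 0 < chordSq A q := by rw [chordSq]; positivity
  have hr : 0 < Real.sqrt (chordSq A q) := Real.sqrt_pos.2 hσ
  have hr2 := Real.sq_sqrt hσ.le
  have hk := one_sub_chordSq hA hy.ne'
  have hk' : 0 < 1 - slopeV A * slopeU A * Real.sqrt (chordSq A q) ^ 2 := by
    rw [hr2, hk]; positivity
  obtain ⟨h1, -, h3⟩ := S.s_arc _ hr.le hk'
  have h2 := S.arc_pos hr hk'
  obtain ⟨hc, hc2⟩ := S.c_arc hr.le hk'
  rw [hr2, hk] at hc2
  have hX2 : Real.exp (invExp S q).1 ^ 2 = nullV A q * (1 - slopeU A * nullU A q) /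
      (nullU A q * (1 + slopeV A * nullV A q)) := by
    rw [← Real.exp_nat_mul, invExp, Nat.cast_ofNat, mul_div_cancel₀ _ two_ne_zero,
      Real.exp_log (by positivity)]
  have ht : (invExp S q).2 = S.arc (Real.sqrt (chordSq A q)) := rfl
  generalize (invExp S q).1 = ψ at *
  rw [ht]
  generalize hT : S.arc (Real.sqrt (chordSq A q)) = t at *
  generalize Real.sqrt (chordSq A q) = r at *
  have hX := Real.exp_pos ψ
  rw [chordSq] at hr2
  -- Only the squares of e^ψ, s and c are explicit; both sides are nonnegative, so comparing squares
  -- suffices.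
  have e1 : Real.exp (-ψ) * S.s t = nullU A q * S.c t / (1 - slopeU A * nullU A q) := by
    rw [← pow_left_inj₀ (by rw [h3]; positivity) (by positivity) two_ne_zero, h3, mul_pow, hr2,
      div_pow, mul_pow, hc2, Real.exp_neg, inv_pow, hX2]
    field_simp
  have e2 : Real.exp ψ * S.s t = nullV A q * S.c t / (1 + slopeV A * nullV A q) := by
    rw [← pow_left_inj₀ (by rw [h3]; positivity) (by positivity) two_ne_zero, h3, mul_pow, hr2,
      div_pow, mul_pow, hc2, hX2]
    field_simp
  have eU : denU S ψ t = S.c t / (1 - slopeU A * nullU A q) := by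
    rw [denU, mul_assoc, e1]
    field_simp
    ring
  have eV : denV S ψ t = S.c t / (1 + slopeV A * nullV A q) := by
    rw [denV, mul_assoc, e2]
    field_simp
    ring
  refine ⟨⟨h2, h1, by rw [eU]; positivity, by rw [eV]; positivity⟩, ?_⟩
  rw [geo, geoU, geoV, e1, e2, eU, eV]
  have e3 : ∀ x P : ℝ, 0 < P → x * S.c t / P / (S.c t / P) = x := fun x P hP => by field_simp
  rw [e3 _ _ hP, e3 _ _ hQ, ofNull_null hA]

theorem contDiff_denU : ContDiff ℝ ∞ fun x : ℝ × ℝ => denU S x.1 x.2 := by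
  have hs := S.contDiff_s.comp (contDiff_snd (𝕜 := ℝ) (E := ℝ) (F := ℝ))
  have hc := S.contDiff_c.comp (contDiff_snd (𝕜 := ℝ) (E := ℝ) (F := ℝ))
  exact hc.add ((contDiff_const.mul (by fun_prop)).mul hs)

theorem contDiff_denV : ContDiff ℝ ∞ fun x : ℝ × ℝ => denV S x.1 x.2 := by
  have hs := S.contDiff_s.comp (contDiff_snd (𝕜 := ℝ) (E := ℝ) (F := ℝ))
  have hc := S.contDiff_c.comp (contDiff_snd (𝕜 := ℝ) (E := ℝ) (F := ℝ))
  exact hc.sub ((contDiff_const.mul (by fun_prop)).mul hs)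

theorem contDiffAt_geo {x : ℝ × ℝ} (hU : denU S x.1 x.2 ≠ 0) (hV : denV S x.1 x.2 ≠ 0) :
    ContDiffAt ℝ ∞ (fun x : ℝ × ℝ => geo S x.1 x.2) x := by
  have hs := (S.contDiff_s.comp (contDiff_snd (𝕜 := ℝ) (E := ℝ) (F := ℝ))).contDiffAt (x := x)
  have he : ContDiffAt ℝ ∞ (fun x : ℝ × ℝ => Real.exp x.1) x := by fun_prop
  have he' : ContDiffAt ℝ ∞ (fun x : ℝ × ℝ => Real.exp (-x.1)) x := by fun_prop
  exact (contDiff_ofNull A).contDiffAt.comp x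
    (((he'.mul hs).div (contDiff_denU S).contDiffAt hU).prodMk
      ((he.mul hs).div (contDiff_denV S).contDiffAt hV))

theorem contDiffAt_invExp (hA : A.det ≠ 0) {q : ℝ × ℝ} (hu : 0 < nullU A q) (hv : 0 < nullV A q)
    (hy : 0 < q.2) (hP : 0 < 1 - slopeU A * nullU A q) (hQ : 0 < 1 + slopeV A * nullV A q) :
    ContDiffAt ℝ ∞ (invExp S) q := by
  have cu := (contDiff_nullU A).contDiffAt (x := q)
  have cv := (contDiff_nullV A).contDiffAt (x := q)
  have cP := (contDiffAt_const (c := (1 : ℝ))).sub ((contDiffAt_const (c := slopeU A)).mul cu)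
  have cQ := (contDiffAt_const (c := (1 : ℝ))).add ((contDiffAt_const (c := slopeV A)).mul cv)
  have hσ : 0 < chordSq A q := by rw [chordSq]; positivity
  have hk' : 0 < 1 - slopeV A * slopeU A * Real.sqrt (chordSq A q) ^ 2 := by
    rw [Real.sq_sqrt hσ.le, one_sub_chordSq hA hy.ne']; positivity
  have cσ : ContDiffAt ℝ ∞ (chordSq A) q := (cu.mul cv).div contDiffAt_snd hy.ne'
  refine ContDiffAt.prodMk (ContDiffAt.div_const (ContDiffAt.log
    ((cv.mul cP).div (cu.mul cQ) (mul_pos hu hQ).ne')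
    (div_pos (mul_pos hv hP) (mul_pos hu hQ)).ne') 2) ?_
  exact (S.contDiffAt_arc _ hk').comp q (cσ.sqrt hσ.ne')

theorem isOpen_geo_source : IsOpen {x : ℝ × ℝ | 0 < x.2 ∧ x.2 ∈ S.I ∧ 0 < denU S x.1 x.2 ∧
    0 < denV S x.1 x.2} :=
  (isOpen_lt continuous_const continuous_snd).inter ((S.isOpen_I.preimage continuous_snd).inter
    ((isOpen_lt continuous_const (contDiff_denU S).continuous).inter
      (isOpen_lt continuous_const (contDiff_denV S).continuous)))

theorem isOpen_M : IsOpen (M A) := by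
  rw [M]
  split_ifs <;> exact isOpen_interior

/-- The exponential map as a diffeomorphism onto `M`. -/
def expDiffeo (hA : 0 < A.det) (ha : 0 ≤ A 0 0) : OpenPartialHomeomorph (ℝ × ℝ) (ℝ × ℝ) where
  toFun x := geo S x.1 x.2
  invFun := invExp S
  source := {x | 0 < x.2 ∧ x.2 ∈ S.I ∧ 0 < denU S x.1 x.2 ∧ 0 < denV S x.1 x.2}
  target := M A
  map_source' x hx := geo_mem S hA ha hx.1 hx.2.1 hx.2.2.1 hx.2.2.2
  map_target' q hq := by
    rw [M_eq hA ha] at hq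
    obtain ⟨h1, h2, h3, h4, h5⟩ := hq
    exact (invExp_spec S hA.ne' h1 h2 h3 h4 h5).1
  left_inv' x hx := invExp_geo S hA.ne' hx.1 hx.2.1 hx.2.2.1 hx.2.2.2
  right_inv' q hq := by
    rw [M_eq hA ha] at hq
    obtain ⟨h1, h2, h3, h4, h5⟩ := hq
    exact (invExp_spec S hA.ne' h1 h2 h3 h4 h5).2
  open_source := isOpen_geo_source S
  open_target := isOpen_M
  continuousOn_toFun x hx :=
    (contDiffAt_geo S hx.2.2.1.ne' hx.2.2.2.ne').continuousAt.continuousWithinAt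
  continuousOn_invFun q hq := by
    rw [M_eq hA ha] at hq
    obtain ⟨h1, h2, h3, h4, h5⟩ := hq
    exact (contDiffAt_invExp S hA.ne' h1 h2 h3 h4 h5).continuousAt.continuousWithinAt

end

noncomputable section

/-! ### Geodesics are length maximizers -/

variable {A : Matrix (Fin 2) (Fin 2) ℝ} (S : CurvTrig (slopeV A * slopeU A))

theorem length_eq_setIntegral {T : ℝ} (hT : 0 ≤ T) (q : ℝ → ℝ × ℝ) :
    length A T q = ∫ t in Set.Ioo 0 T, Real.sqrt |metric A (q t) (deriv q t) (deriv q t)| := by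
  rw [length, intervalIntegral.integral_of_le hT, MeasureTheory.integral_Ioc_eq_integral_Ioo]

/-- Here a = u', b = v', z = √σ and C = c(arc z), so the right side is the derivative of arc √σ
along the curve. After squaring, the claim is 4XY ≤ (X + Y)² with X = a v Q and Y = u b P. -/
theorem sqrt_abs_metric_le {u v y P Q a b z C : ℝ} (hu : 0 < u) (hv : 0 < v) (hy : 0 < y)
    (hP : 0 < P) (hQ : 0 < Q) (ha : 0 ≤ a) (hb : 0 ≤ b) (hC : 0 < C) (hC2 : C ^ 2 = P * Q / y)
    (hz : 0 < z) (hz2 : z ^ 2 = u * v / y) :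
    Real.sqrt |-(a * b) / y ^ 2| ≤ C⁻¹ * ((a * v * Q + u * b * P) / y ^ 2 / (2 * z)) := by
  rw [Real.sqrt_le_iff]
  refine ⟨by positivity, ?_⟩
  rw [neg_div, abs_neg, abs_of_nonneg (by positivity), mul_pow, inv_pow, hC2, div_pow, mul_pow,
    hz2]
  have h : a * b / y ^ 2 = (4 * (a * v * Q) * (u * b * P)) / (4 * y ^ 2 * (P * Q * u * v)) := by
    field_simp
  have h' : (P * Q / y)⁻¹ * (((a * v * Q + u * b * P) / y ^ 2) ^ 2 / (2 ^ 2 * (u * v / y))) =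
      (a * v * Q + u * b * P) ^ 2 / (4 * y ^ 2 * (P * Q * u * v)) := by
    field_simp
    norm_num
  rw [h, h']
  gcongr
  nlinarith [sq_nonneg (a * v * Q - u * b * P)]

theorem one_sub_mul_pos {l x z : ℝ} (h0 : 0 ≤ x) (hxz : x ≤ z) (h : 0 < 1 - l * z) :
    0 < 1 - l * x := by
  rcases le_total l 0 with hl | hl <;> nlinarith

/-- The function φ = arc √σ along the curve is nondecreasing, starts at 0, and its derivative
dominates the length density almost everywhere. -/
theorem length_le_arc (hA : 0 < A.det) (ha : 0 ≤ A 0 0) {T : ℝ} {q : ℝ → ℝ × ℝ}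
    (hq : IsFutureCurve A T q) (h0 : q 0 = Id) (hM : q T ∈ M A) :
    length A T q ≤ S.arc (Real.sqrt (chordSq A (q T))) := by
  have hA' := hA.ne'
  have hT := hq.1
  have m0 : (0 : ℝ) ∈ Set.Icc 0 T := ⟨le_rfl, hT⟩
  have mT : T ∈ Set.Icc 0 T := ⟨hT, le_rfl⟩
  rw [M_eq hA ha] at hM
  obtain ⟨-, -, -, hMP, hMQ⟩ := hM
  have monoU := hq.monotoneOn_nullU hA'
  have monoV := hq.monotoneOn_nullV hA'
  have hU : ∀ t ∈ Set.Icc 0 T, 0 ≤ nullU A (q t) := fun t ht => by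
    simpa [h0, nullU_Id] using monoU m0 ht ht.1
  have hV : ∀ t ∈ Set.Icc 0 T, 0 ≤ nullV A (q t) := fun t ht => by
    simpa [h0, nullV_Id] using monoV m0 ht ht.1
  -- Since 0 ≤ u(t) ≤ u(T), positivity at the endpoint holds along the whole curve; likewise for v.
  have hP : ∀ t ∈ Set.Icc 0 T, 0 < 1 - slopeU A * nullU A (q t) := fun t ht =>
    one_sub_mul_pos (hU t ht) (monoU ht mT ht.2) hMP
  have hQ : ∀ t ∈ Set.Icc 0 T, 0 < 1 + slopeV A * nullV A (q t) := fun t ht => by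
    have := one_sub_mul_pos (l := -slopeV A) (hV t ht) (monoV ht mT ht.2) (by linarith)
    linarith
  have hy : ∀ t ∈ Set.Icc 0 T, 0 < (q t).2 := fun t ht => hq.2.1 t ht
  have hσ : ∀ t ∈ Set.Icc 0 T, 0 ≤ chordSq A (q t) := fun t ht =>
    div_nonneg (mul_nonneg (hU t ht) (hV t ht)) (hy t ht).le
  have hk : ∀ t ∈ Set.Icc 0 T,
      0 < 1 - slopeV A * slopeU A * Real.sqrt (chordSq A (q t)) ^ 2 := fun t ht => by
    rw [Real.sq_sqrt (hσ t ht), one_sub_chordSq hA' (hy t ht).ne']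
    exact div_pos (mul_pos (hP t ht) (hQ t ht)) (hy t ht)
  have monoσ : MonotoneOn (fun t => chordSq A (q t)) (Set.Icc 0 T) := by
    intro t₁ h₁ t₂ h₂ h
    simp only [chordSq]
    rw [div_le_div_iff₀ (hy t₁ h₁) (hy t₂ h₂), snd_eq hA' (q t₁), snd_eq hA' (q t₂)]
    -- The cross-multiplied difference u₂v₂y₁ - u₁v₁y₂ equals v₂ (u₂ - u₁)(1 + m v₁) + u₁ (v₂ -
    -- v₁)(1 - n u₂).
    have e1 := mul_nonneg (mul_nonneg (hV t₂ h₂) (sub_nonneg.2 (monoU h₁ h₂ h))) (hQ t₁ h₁).le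
    have e2 := mul_nonneg (mul_nonneg (hU t₁ h₁) (sub_nonneg.2 (monoV h₁ h₂ h))) (hP t₂ h₂).le
    simp only at e1 e2
    linarith
  set φ : ℝ → ℝ := fun t => S.arc (Real.sqrt (chordSq A (q t))) with hφ
  have monoφ : MonotoneOn φ (Set.Icc 0 T) := fun t₁ h₁ t₂ h₂ h =>
    S.arc_mono (Real.sqrt_nonneg _) (Real.sqrt_le_sqrt (monoσ h₁ h₂ h)) (hk t₂ h₂)
  have hφ0 : φ 0 = 0 := by simp [hφ, h0, chordSq, nullU_Id, S.arc_zero]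
  have monoφ' : MonotoneOn φ (Set.uIcc 0 T) := by rwa [Set.uIcc_of_le hT]
  -- Lebesgue's inequality ∫ φ' ≤ φ(T) - φ(0) for monotone φ suffices. Absolute continuity is not
  -- needed, which matters because of the square root at σ = 0.
  have hint := monoφ'.intervalIntegral_deriv_mem_uIcc
  rw [hφ0, sub_zero, Set.uIcc_of_le (hφ0 ▸ monoφ m0 mT hT)] at hint
  refine le_trans ?_ hint.2
  rw [length_eq_setIntegral hT, intervalIntegral.integral_of_le hT,
    MeasureTheory.integral_Ioc_eq_integral_Ioo]
  refine MeasureTheory.integral_mono_of_nonneg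
    (Filter.Eventually.of_forall fun t => Real.sqrt_nonneg _) ?_ ?_
  · have := monoφ'.intervalIntegrable_deriv
    rw [intervalIntegrable_iff_integrableOn_Ioo_of_le hT] at this
    exact this
  · filter_upwards [MeasureTheory.ae_restrict_of_ae_restrict_of_subset Set.Ioo_subset_Icc_self
      (hq.ae_deriv hA'), MeasureTheory.ae_restrict_mem measurableSet_Ioo] with t ht hmem
    obtain ⟨hd, hda, hdb⟩ := ht
    have hnhds : Set.Icc 0 T ∈ nhds t := Icc_mem_nhds hmem.1 hmem.2
    have htm := Set.Ioo_subset_Icc_self hmem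
    have dU := hasDerivAt_nullU (A := A) hd
    have dV := hasDerivAt_nullV (A := A) hd
    rw [metric_self]
    have hdeg : dirU A (deriv q t) * dirV A (deriv q t) = 0 →
        Real.sqrt |-(dirU A (deriv q t) * dirV A (deriv q t)) / (q t).2 ^ 2| ≤ deriv φ t := by
      intro h
      rw [h, neg_zero, zero_div, abs_zero, Real.sqrt_zero, ← derivWithin_of_mem_nhds hnhds]
      exact monoφ.derivWithin_nonneg
    -- Where u = 0 at an interior time, u has a local minimum, so u' = 0 and the length density
    -- vanishes. The same holds for v.
    rcases (hU t htm).eq_or_lt with hu | hu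
    · refine hdeg ?_
      have hmin : IsLocalMin (fun t => nullU A (q t)) t := by
        filter_upwards [hnhds] with x hx
        rw [← hu]
        exact hU x hx
      rw [hmin.hasDerivAt_eq_zero dU, zero_mul]
    rcases (hV t htm).eq_or_lt with hv | hv
    · refine hdeg ?_
      have hmin : IsLocalMin (fun t => nullV A (q t)) t := by
        filter_upwards [hnhds] with x hx
        rw [← hv]
        exact hV x hx
      rw [hmin.hasDerivAt_eq_zero dV, mul_zero]
    have hyt := hy t htm
    have hσt : 0 < chordSq A (q t) := div_pos (mul_pos hu hv) hyt
    have hr := Real.sqrt_pos.2 hσt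
    have dy : HasDerivAt (fun t => (q t).2)
        (slopeV A * dirV A (deriv q t) - slopeU A * dirU A (deriv q t)) t := by
      rw [show (fun t => (q t).2) = _ from funext fun t => snd_eq hA' (q t)]
      exact ((dV.const_mul _).const_add 1).sub (dU.const_mul _)
    have dσ : HasDerivAt (fun t => chordSq A (q t))
        ((dirU A (deriv q t) * nullV A (q t) * (1 + slopeV A * nullV A (q t)) +
          nullU A (q t) * dirV A (deriv q t) * (1 - slopeU A * nullU A (q t))) / (q t).2 ^ 2) t := by
      refine ((dU.mul dV).div dy hyt.ne').congr_deriv ?_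
      congr 1
      simp only [Pi.mul_apply]
      rw [snd_eq hA' (q t)]
      ring
    have hc := S.c_arc hr.le (hk t htm)
    have dφ : HasDerivAt φ _ t :=
      (S.hasDerivAt_arc hr (hk t htm)).comp t (dσ.sqrt hσt.ne')
    rw [dφ.deriv]
    refine sqrt_abs_metric_le hu hv hyt (hP t htm) (hQ t htm) hda hdb hc.1 ?_ hr
      (Real.sq_sqrt hσt.le)
    rw [hc.2, Real.sq_sqrt hσt.le, one_sub_chordSq hA' hyt.ne']

/-- The geodesic has unit speed, hence length t₁. At its endpoint √σ = s(t₁), so the bound of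
`length_le_arc` for competing curves is exactly t₁. -/
theorem isLengthMaximizer_Exp (hA : 0 < A.det) (ha : 0 ≤ A 0 0) {ψ t₁ : ℝ} (h0 : 0 < t₁)
    (h : ∀ x ∈ Set.Icc 0 t₁, 0 < denU S ψ x ∧ 0 < denV S ψ x) :
    IsLengthMaximizer A Id (Exp A (covector A ψ) t₁) t₁ (fun t => Exp A (covector A ψ) t) := by
  have hA' := hA.ne'
  have hE : ∀ t ∈ Set.Icc 0 t₁, Exp A (covector A ψ) t = geo S ψ t := fun t ht =>
    Exp_eq_geo S hA' ht.1 fun x hx => h x ⟨hx.1, hx.2.trans ht.2⟩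
  -- `deriv` is two-sided and `Exp` has its junk value for t < 0, so derivatives are compared on the
  -- open interval, which has full measure.
  have hd : ∀ t ∈ Set.Ioo 0 t₁, deriv (fun t => Exp A (covector A ψ) t) t = deriv (geo S ψ) t :=
    fun t ht => Filter.EventuallyEq.deriv_eq (by
      filter_upwards [Icc_mem_nhds ht.1 ht.2] with x hx using hE x hx)
  have hgd : ∀ t ∈ Set.Icc 0 t₁, dirU A (deriv (geo S ψ) t) = Real.exp (-ψ) / denU S ψ t ^ 2 ∧
      dirV A (deriv (geo S ψ) t) = Real.exp ψ / denV S ψ t ^ 2 := fun t ht => by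
    obtain ⟨w, h1, h2, h3⟩ := hasDerivAt_geo S hA' (h t ht).1.ne' (h t ht).2.ne'
    rw [h3.deriv]
    exact ⟨h1, h2⟩
  have hG : ∀ t ∈ Set.Icc 0 t₁, geo S ψ t ∈ G := fun t ht => by
    change 0 < (geo S ψ t).2
    obtain ⟨h1, h2⟩ := h t ht
    rw [geo_snd S h1.ne' h2.ne']
    positivity
  have hId : geo S ψ 0 = Id := by
    rw [geo, geoU_zero, geoV_zero]
    simp [ofNull, Id]
  have hm : (0 : ℝ) < slopeV A * slopeU A → 0 < slopeV A := fun h => (slope_pos hA ha h).1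
  obtain ⟨hI, hU1, hV1⟩ := (den_pos_iff hm h0.le).1 h
  have m1 : t₁ ∈ Set.Icc 0 t₁ := ⟨h0.le, le_rfl⟩
  refine ⟨⟨h0.le, fun t ht => ?_, ?_, ?_⟩, ?_, rfl, ?_⟩
  · change Exp A _ t ∈ G
    rw [hE t ht]
    exact hG t ht
  · have hcd : ContDiffOn ℝ 1 (geo S ψ) (Set.Icc 0 t₁) := fun t ht => by
      have h1 := (contDiffAt_geo S (x := (ψ, t)) (h t ht).1.ne' (h t ht).2.ne').of_le
        (m := 1) (by exact_mod_cast le_top)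
      have h2 : ContDiffAt ℝ 1 (fun t : ℝ => ((ψ, t) : ℝ × ℝ)) t := by fun_prop
      exact (h1.comp t h2).contDiffWithinAt
    obtain ⟨L, hL⟩ := hcd.exists_lipschitzOnWith one_ne_zero (convex_Icc 0 t₁) isCompact_Icc
    exact ⟨L, fun x hx y hy => by
      change edist (Exp A _ x) (Exp A _ y) ≤ _
      rw [hE x hx, hE y hy]; exact hL hx hy⟩
  · rw [← MeasureTheory.restrict_Ioo_eq_restrict_Icc]
    filter_upwards [MeasureTheory.ae_restrict_mem measurableSet_Ioo] with t ht
    have ht' := Set.Ioo_subset_Icc_self ht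
    obtain ⟨h1, h2⟩ := h t ht'
    rw [hd t ht, hE t ht', isFutureNonspacelike_iff hA' (hG t ht'), (hgd t ht').1, (hgd t ht').2]
    exact ⟨by positivity, by positivity, by positivity⟩
  · change Exp A _ 0 = _
    rw [hE 0 ⟨le_rfl, h0.le⟩, hId]
  · intro T' q' hq' h0' h1'
    rw [hE t₁ m1] at h1'
    have hle := length_le_arc S hA ha hq' h0' (h1' ▸ geo_mem S hA ha h0 hI hU1 hV1)
    rw [h1', chordSq_geo S hA' hU1.ne' hV1.ne', Real.sqrt_sq (S.s_pos t₁ hI h0).le,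
      S.arc_s t₁ hI h0.le] at hle
    refine hle.trans_eq ?_
    rw [length_eq_setIntegral h0.le]
    have : ∀ t ∈ Set.Ioo 0 t₁, Real.sqrt |metric A (Exp A (covector A ψ) t)
        (deriv (fun t => Exp A (covector A ψ) t) t)
        (deriv (fun t => Exp A (covector A ψ) t) t)| = 1 := fun t ht => by
      have ht' := Set.Ioo_subset_Icc_self ht
      obtain ⟨h1, h2⟩ := h t ht'
      rw [hd t ht, hE t ht', metric_self, (hgd t ht').1, (hgd t ht').2,
        geo_snd S h1.ne' h2.ne', Real.exp_neg]
      have : -((Real.exp ψ)⁻¹ / denU S ψ t ^ 2 * (Real.exp ψ / denV S ψ t ^ 2)) /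
          (1 / (denU S ψ t * denV S ψ t)) ^ 2 = -1 := by field_simp
      rw [this]
      norm_num
    rw [MeasureTheory.setIntegral_congr_fun measurableSet_Ioo this]
    simp [h0.le]

end

end AffLorentz

/-! ### The main theorem -/

open AffLorentz in
theorem mainTheorem1 (A : Matrix (Fin 2) (Fin 2) ℝ) (hdet : 0 < A.det) (ha : 0 ≤ A 0 0) :
    (∀ p t, (p, t) ∈ AffLorentz.N A → AffLorentz.Exp A p t ∈ AffLorentz.M A) ∧
    (∃ Φ : OpenPartialHomeomorph (ℝ × ℝ) (ℝ × ℝ),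
      Φ.source = {s | (AffLorentz.covector A s.1, s.2) ∈ AffLorentz.N A} ∧
      Φ.target = AffLorentz.M A ∧
      (∀ s ∈ Φ.source, Φ s = AffLorentz.Exp A (AffLorentz.covector A s.1) s.2) ∧
      ContDiffOn ℝ ∞ Φ Φ.source ∧
      ContDiffOn ℝ ∞ Φ.symm Φ.target) ∧
    (∀ p ∈ AffLorentz.C A, ∀ t₁ : ℝ, 0 < t₁ → (t₁ : EReal) < AffLorentz.tMax A p →
      AffLorentz.IsLengthMaximizer A AffLorentz.Id (AffLorentz.Exp A p t₁) t₁
        (fun t => AffLorentz.Exp A p t)) := by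
  obtain ⟨S⟩ := nonempty_curvTrig (slopeV A * slopeU A)
  have hA := hdet.ne'
  have hm : 0 < slopeV A * slopeU A → 0 < slopeV A := fun h => (slope_pos hdet ha h).1
  have hcov : ∀ p ∈ AffLorentz.C A, ∃ ψ, covector A ψ = p := fun p hp => by
    obtain ⟨ψ, -, h⟩ := (bijOn_covector A hA).surjOn hp
    exact ⟨ψ, h⟩
  have hExp : ∀ ψ t, 0 < t → t ∈ S.I → 0 < denU S ψ t → 0 < denV S ψ t →
      AffLorentz.Exp A (covector A ψ) t = geo S ψ t := fun ψ t h0 h1 h2 h3 =>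
    Exp_eq_geo S hA h0.le ((den_pos_iff hm h0.le).2 ⟨h1, h2, h3⟩)
  refine ⟨fun p t h => ?_, ⟨expDiffeo S hdet ha, ?_, rfl, ?_, ?_, ?_⟩, fun p hp t₁ h0 h => ?_⟩
  · obtain ⟨ψ, rfl⟩ := hcov p h.1
    obtain ⟨h0, h1, h2, h3⟩ := (covector_mem_N S hA hm).1 h
    rw [hExp ψ t h0 h1 h2 h3]
    exact geo_mem S hdet ha h0 h1 h2 h3
  · ext x
    exact (covector_mem_N S hA hm).symm
  · rintro x ⟨h0, h1, h2, h3⟩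
    exact (hExp x.1 x.2 h0 h1 h2 h3).symm
  · rintro x ⟨-, -, h2, h3⟩
    exact (contDiffAt_geo S h2.ne' h3.ne').contDiffWithinAt
  · intro q hq
    change q ∈ AffLorentz.M A at hq
    rw [M_eq hdet ha] at hq
    obtain ⟨h1, h2, h3, h4, h5⟩ := hq
    exact (contDiffAt_invExp S hA h1 h2 h3 h4 h5).contDiffWithinAt
  · obtain ⟨ψ, rfl⟩ := hcov p hp
    exact isLengthMaximizer_Exp S hdet ha h0 ((lt_tMax_iff S hA h0.le).1 h)
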